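/- \textbf{Setting.} A probabilistic transition system specification (PTSS) $P=(\Sigma,A,R)$ in PGSOS format consists of a signature $\Sigma$, a set $A$ of actions and a set $R$ of rules $$\frac{\{x_i\xrightarrow{a_{i,k}}\mu_{i,k}\mid 1\le i\le n,\ k\in K_i\}\qquad\{x_i\not\xrightarrow{b_{i,j}}\ \mid 1\le i\le n,\ j\in L_i\}}{f(x_1,\dots,x_n)\xrightarrow{a}\theta}$$ with $f\in\Sigma$ of rank $n$, finite index sets $K_i,L_i$, pairwise distinct state variables $x_i$ and distribution variables $\mu_{i,k}$, and a distribution term $\theta$ over these variables (built from distribution variables, Dirac distributions $\delta(t)$ of state terms $t$, convex combinations, and operators of $\Sigma$ applied to distribution terms), such that for every operator $f$ and action $a$ there are only finitely many rules with an $a$-labelled conclusion for $f$. It induces a unique supported transition relation $t\xrightarrow{a}\pi$ between closed terms $t\in T(\Sigma)$ and (discrete) probability distributions $\pi$ on $T(\Sigma)$; here $f(\pi_1,\dots,\pi_n)$ is the image of the product distribution under $f$. Let $\mathrm{der}(t,a)=\{\pi\mid t\xrightarrow{a}\pi\}$. For $d\colon T(\Sigma)^2\to[0,1]$ let $\mathbf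 K(d)(\pi,\pi')=\min_\omega\sum_{t,t'}d(t,t')\,\omega(t,t')$ over all couplings $\omega$ of $\pi,\pi'$, and let $\mathbf H$ be the Hausdorff lifting (with $\inf\emptyset=1$, $\sup\emptyset=0$). For $\lambda\in(0,1]$, a $1$-bounded pseudometric $d$ on $T(\Sigma)$ is a \emph{$\lambda$-bisimulation metric} if, whenever $d(t,t')<1$ and $t\xrightarrow{a}\pi$, there is $t'\xrightarrow{a}\pi'$ with $\lambda\,\mathbf K(d)(\pi,\pi')\le d(t,t')$; the \emph{$\lambda$-bisimilarity metric} $\mathbf d$ is the smallest one. The \emph{up-to-$k$ $\lambda$-bisimilarity metric} is $\mathbf d_k=\mathbf B^k(\mathbf 0)$, where $\mathbf B(d)(t,t')=\sup_{a\in A}\mathbf H(\lambda\cdot\mathbf K(d))(\mathrm{der}(t,a),\mathrm{der}(t',a))$. An $n$-ary operator $f$ is \emph{uniformly continuous} w.r.t.\ $d$ if for all $\varepsilon>0$ there are $\delta_1,\dots,\delta_n>0$ such that, for all closed terms $s_i,t_i$, $d(s_i,t_i)<\delta_i$ for all $i$ implies $d(f(s_1,\dots,s_n),f(t_1,\dots,t_n))<\varepsilon$.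 It is \emph{$K$-Lipschitz continuous} w.r.t.\ $d$, for $K\in\mathbb R_{\ge0}$, if $d(f(s_1,\dots,s_n),f(t_1,\dots,t_n))\le K\sum_i d(s_i,t_i)$ for all closed terms $s_i,t_i$, and \emph{Lipschitz continuous} if it is so for some $K$. Fix a termination action $\surd$, forking actions $l,r$ and a split action $s$ in $A$. Let $P_{\mathsf{cp}}$ be the PTSS with the operators stop $0$, probabilistic prefix $a.\bigoplus_{i=1}^n[p_i]\_$ ($a\in A$, $n\ge1$, $p_i\in(0,1]$, $\sum_ip_i=1$), alternative composition $+$, synchronous parallel composition $\mid$ and copy $\mathsf{cp}$, and the rules $$\frac{}{a.\bigoplus_i[p_i]x_i\xrightarrow{a}\sum_ip_i\delta(x_i)}\qquad\frac{x\xrightarrow{a}\mu}{x+y\xrightarrow{a}\mu}\qquad\frac{y\xrightarrow{a}\nu}{x+y\xrightarrow{a}\nu}\qquad\frac{x\xrightarrow{a}\mu\quad y\xrightarrow{a}\nu}{x\mid y\xrightarrow{a}\mu\mid\nu}\ (a\ne\surd)\qquad\frac{x\xrightarrow{\surd}\mu\quad y\xrightarrow{\surd}\nu}{x\mid y\xrightarrow{\surd}\delta(0)}$$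 $$\frac{x\xrightarrow{a}\mu}{\mathsf{cp}(x)\xrightarrow{a}\mu}\ (a\notin\{l,r\})\qquad\frac{x\xrightarrow{l}\mu\quad x\xrightarrow{r}\nu}{\mathsf{cp}(x)\xrightarrow{s}\mathsf{cp}(\mu)\mid\mathsf{cp}(\nu)}.$$ \textbf{Theorem.} Let $P=(\Sigma,A,R)$ be any PTSS in PGSOS format that is a disjoint extension of $P_{\mathsf{cp}}$ (i.e.\ it contains the operators and rules of $P_{\mathsf{cp}}$ and no further rule for these operators). Then: \begin{enumerate} \item for every $\lambda\in(0,1)$, $\mathsf{cp}$ is uniformly continuous w.r.t.\ the $\lambda$-bisimilarity metric $\mathbf d$; \item for every $\lambda\in(0,1]$ and every $k\ge0$, $\mathsf{cp}$ is $2^k$-Lipschitz continuous w.r.t.\ the up-to-$k$ $\lambda$-bisimilarity metric $\mathbf d_k$; \item if $s\neq\surd$, then for every $\lambda\in(0,1]$, $\mathsf{cp}$ is not Lipschitz continuous w.r.t.\ the $\lambda$-bisimilarity metric $\mathbf d$. \end{enumerate} -/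

import Mathlib

open scoped NNReal ENNReal

universe u v w

namespace PGSOS

/-! ### Signatures and terms -/

/-- A signature: a type of operators with a rank function. -/
structure Signature where
  Op : Type u
  ar : Op → ℕ

/-- State terms over a signature with state variables in `V`. -/
inductive Term (S : Signature.{u}) (V : Type) : Type u where
  | var (x : V) : Term S V
  | app (f : S.Op) (ts : Fin (S.ar f) → Term S V) : Term S V

/-- Closed terms, i.e. processes. -/
abbrev Proc (S : Signature.{u}) : Type u := Term S Empty

def Term.subst {S : Signature.{u}} {V W : Type} (σ : V → Term S W) : Term S V → Term S W
  | .var x => σ x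
  | .app f ts => .app f (fun i => (ts i).subst σ)

/-- The product distribution of finitely many distributions. -/
noncomputable def prodPMF {α : Type u} : (n : ℕ) → (Fin n → PMF α) → PMF (Fin n → α)
  | 0, _ => PMF.pure Fin.elim0
  | n + 1, π => (π 0).bind fun x => (prodPMF n (fun i => π i.succ)).map (Fin.cons x)

theorem prodPMF_apply {α : Type u} (n : ℕ) (π : Fin n → PMF α) (x : Fin n → α) :
    prodPMF n π x = ∏ i, π i (x i) := by
  induction n with
  | zero => simp [prodPMF, PMF.pure_apply, Subsingleton.elim x Fin.elim0]
  | succ n ih =>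
    classical
    have key : ∀ y, ((prodPMF n fun i => π i.succ).map (@Fin.cons n (fun _ => α) y)) x =
        if y = x 0 then ∏ i : Fin n, π i.succ (x i.succ) else 0 := by
      intro y
      rw [PMF.map_apply]
      split_ifs with h
      · subst h
        rw [tsum_eq_single (Fin.tail x), if_pos (Fin.cons_self_tail x).symm, ih]
        · rfl
        · intro z hz
          rw [if_neg]
          intro hx
          exact hz (by rw [hx, Fin.tail_cons])
      · refine ENNReal.tsum_eq_zero.2 fun z => if_neg ?_
        intro hx
        exact h (by rw [hx]; simp)
    rw [prodPMF, PMF.bind_apply, Fin.prod_univ_succ, tsum_eq_single (x 0)]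
    · rw [key, if_pos rfl]
    · intro y hy
      rw [key, if_neg hy, mul_zero]

/-- Distribution terms with state variables in `V` and distribution variables in `D`: variables,
instantiable Dirac distributions, (finite or countable) convex combinations, and lifted operators.
A distribution on the index type `I` is a family of weights that sum up to `1`. -/
inductive DTerm (S : Signature.{u}) (V D : Type) : Type (max u 1) where
  | var (μ : D) : DTerm S V D
  | dirac (t : Term S V) : DTerm S V D
  | sum (I : Type) (p : PMF I) (θ : I → DTerm S V D) : DTerm S V D
  | app (f : S.Op) (θ : Fin (S.ar f) → DTerm S V D) : DTerm S V D

/-- The distribution over processes denoted by a distribution term under a closed substitution. -/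
noncomputable def DTerm.eval {S : Signature.{u}} {V D : Type} (σ : V → Proc S)
    (ρ : D → PMF (Proc S)) : DTerm S V D → PMF (Proc S)
  | .var μ => ρ μ
  | .dirac t => PMF.pure (t.subst σ)
  | .sum _ p θ => p.bind fun i => (θ i).eval σ ρ
  | .app f θ => (prodPMF (S.ar f) fun i => (θ i).eval σ ρ).map (Term.app f)

/-! ### PGSOS rules, transition system specifications, induced model -/

/-- A PGSOS rule for an operator of rank `n`, without the operator and the label of its conclusion.
The source variables are `x_i`, `i : Fin n`.  For `k : Fin numPos` there is a positive premise
`x_(posArg k) ⟶ μ_k` with label `posLabel k`, for `j : Fin numNeg` there is a negative premise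
saying that `x_(negArg j)` has no transition with label `negLabel j`; the target is a distribution term over the `x_i` and the `μ_k`. -/
structure Rule (S : Signature.{u}) (A : Type v) (n : ℕ) where
  numPos : ℕ
  posArg : Fin numPos → Fin n
  posLabel : Fin numPos → A
  numNeg : ℕ
  negArg : Fin numNeg → Fin n
  negLabel : Fin numNeg → A
  target : DTerm S (Fin n) (Fin numPos)

/-- A probabilistic transition system specification in PGSOS format. `rules f a` is the set of the
rules whose conclusion is an `a`-labelled transition of a term with head operator `f`. -/
structure PTSS (S : Signature.{u}) (A : Type v) where
  rules : (f : S.Op) → A → Set (Rule S A (S.ar f))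
  finite_rules : ∀ f a, (rules f a).Finite

/-- The instance of `r` given by the processes `ts` for the source variables allows to derive a
transition to `π` from the transition relation `M`. -/
def Rule.Derives {S : Signature.{u}} {A : Type v} {n : ℕ} (r : Rule S A n) (ts : Fin n → Proc S)
    (M : Fin n → A → PMF (Proc S) → Prop) (π : PMF (Proc S)) : Prop :=
  ∃ ρ : Fin r.numPos → PMF (Proc S),
    (∀ k, M (r.posArg k) (r.posLabel k) (ρ k)) ∧
    (∀ j, ∀ π', ¬ M (r.negArg j) (r.negLabel j) π') ∧
    π = r.target.eval ts ρ

/-- The transition relation of the induced (i.e. the unique supported) model of `P`: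
`P.step t a π` means `t ⟶[a] π`. -/
def PTSS.step {S : Signature.{u}} {A : Type v} (P : PTSS S A) :
    Proc S → A → PMF (Proc S) → Prop
  | .var x => x.elim
  | .app f ts => fun a π => ∃ r ∈ P.rules f a, r.Derives ts (fun i => P.step (ts i)) π

/-- A transition relation is a supported model of `P` if it consists of exactly the transitions
that are derivable from it by a rule of `P`. -/
def PTSS.IsSupportedModel {S : Signature.{u}} {A : Type v} (P : PTSS S A)
    (M : Proc S → A → PMF (Proc S) → Prop) : Prop :=
  ∀ (f : S.Op) (ts : Fin (S.ar f) → Proc S) (a : A) (π : PMF (Proc S)),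
    M (.app f ts) a π ↔ ∃ r ∈ P.rules f a, r.Derives ts (fun i => M (ts i)) π

theorem PTSS.isSupportedModel_iff {S : Signature.{u}} {A : Type v} (P : PTSS S A)
    (M : Proc S → A → PMF (Proc S) → Prop) : P.IsSupportedModel M ↔ M = P.step := by
  constructor
  · intro h
    funext t
    induction t with
    | var x => exact x.elim
    | app f ts ih =>
      funext a π
      have h1 := h f ts a π
      simp only [ih] at h1
      exact propext h1
  · rintro rfl f ts a π
    exact Iff.rfl

/-- The set of the `a`-derivatives of `t`. -/
def PTSS.der {S : Signature.{u}} {A : Type v} (P : PTSS S A) (t : Proc S) (a : A) :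
    Set (PMF (Proc S)) :=
  {π | P.step t a π}

/-! ### Disjoint extensions -/

/-- An inclusion of signatures: an injection of the operators that preserves the rank. -/
structure Signature.Embedding (S₁ : Signature.{u}) (S₂ : Signature.{v}) where
  toFun : S₁.Op → S₂.Op
  injective : Function.Injective toFun
  ar_eq : ∀ f, S₂.ar (toFun f) = S₁.ar f

def Term.map {S₁ : Signature.{u}} {S₂ : Signature.{v}} (e : S₁.Embedding S₂) {V W : Type}
    (g : V → W) : Term S₁ V → Term S₂ W
  | .var x => .var (g x)
  | .app f ts => .app (e.toFun f) (fun i => (ts (Fin.cast (e.ar_eq f) i)).map e g)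

def DTerm.map {S₁ : Signature.{u}} {S₂ : Signature.{v}} (e : S₁.Embedding S₂) {V W D : Type}
    (g : V → W) : DTerm S₁ V D → DTerm S₂ W D
  | .var μ => .var μ
  | .dirac t => .dirac (t.map e g)
  | .sum I p θ => .sum I p (fun i => (θ i).map e g)
  | .app f θ => .app (e.toFun f) (fun i => (θ (Fin.cast (e.ar_eq f) i)).map e g)

/-- A rule over `S₁` read as a rule over `S₂`. -/
def Rule.map {S₁ : Signature.{u}} {S₂ : Signature.{v}} (e : S₁.Embedding S₂) {A : Type w}
    {n m : ℕ} (h : n = m) (r : Rule S₁ A n) : Rule S₂ A m where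
  numPos := r.numPos
  posArg := fun k => Fin.cast h (r.posArg k)
  posLabel := r.posLabel
  numNeg := r.numNeg
  negArg := fun j => Fin.cast h (r.negArg j)
  negLabel := r.negLabel
  target := r.target.map e (Fin.cast h)

/-- `P₂` is a disjoint extension of `P₁`: it has all the operators and the rules of `P₁`, and no
new rule for an operator of `P₁`. -/
def IsDisjointExtension {S₁ : Signature.{u}} {S₂ : Signature.{v}} {A : Type w}
    (e : S₁.Embedding S₂) (P₁ : PTSS S₁ A) (P₂ : PTSS S₂ A) : Prop :=
  ∀ (f : S₁.Op) (a : A), P₂.rules (e.toFun f) a = Rule.map e (e.ar_eq f).symm '' P₁.rules f a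

/-! ### Bisimulation metrics

Distances are `ℝ≥0∞`-valued functions bounded by `1`. -/

/-- `1`-bounded pseudometrics. -/
structure IsPseudometric {X : Type u} (d : X → X → ℝ≥0∞) : Prop where
  le_one : ∀ x y, d x y ≤ 1
  refl : ∀ x, d x x = 0
  symm : ∀ x y, d x y = d y x
  triangle : ∀ x y z, d x z ≤ d x y + d y z

/-- `ω` is a matching (coupling) for `(π, π')`. -/
def IsMatching {X : Type u} (π π' : PMF X) (ω : PMF (X × X)) : Prop :=
  ω.map Prod.fst = π ∧ ω.map Prod.snd = π'

/-- The Kantorovich lifting. -/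
noncomputable def kantorovich {X : Type u} (d : X → X → ℝ≥0∞) (π π' : PMF X) : ℝ≥0∞ :=
  ⨅ (ω : PMF (X × X)) (_ : IsMatching π π' ω), ∑' x : X × X, d x.1 x.2 * ω x

/-- The Hausdorff lifting of a function bounded by `1`, with `inf ∅ = 1` and `sup ∅ = 0`. -/
noncomputable def hausdorff {Y : Type u} (d : Y → Y → ℝ≥0∞) (B C : Set Y) : ℝ≥0∞ :=
  max (⨆ y ∈ B, min 1 (⨅ z ∈ C, d y z)) (⨆ z ∈ C, min 1 (⨅ y ∈ B, d z y))

section Metric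

variable {S : Signature.{u}} {A : Type v} (P : PTSS S A) (lam : ℝ≥0)

/-- `lam`-bisimulation metrics on the induced model of `P`. -/
structure IsBisimulationMetric (d : Proc S → Proc S → ℝ≥0∞) : Prop where
  isPseudometric : IsPseudometric d
  transfer : ∀ t t', d t t' < 1 → ∀ a π, P.step t a π →
    ∃ π', P.step t' a π' ∧ lam * kantorovich d π π' ≤ d t t'

/-- The `lam`-bisimilarity metric: the infimum, in the pointwise order, of all
`lam`-bisimulation metrics. -/
noncomputable def bisimilarityMetric : Proc S → Proc S → ℝ≥0∞ :=
  sInf {d | IsBisimulationMetric P lam d}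

/-- The bisimulation metric functional. -/
noncomputable def bisimFunctional (d : Proc S → Proc S → ℝ≥0∞) : Proc S → Proc S → ℝ≥0∞ :=
  fun t t' => ⨆ a : A, hausdorff (fun π π' => lam * kantorovich d π π') (P.der t a) (P.der t' a)

/-- The up-to-`k` bisimilarity metric. -/
noncomputable def upToMetric (k : ℕ) : Proc S → Proc S → ℝ≥0∞ :=
  (bisimFunctional P lam)^[k] (fun _ _ => 0)

end Metric

/-! ### Continuity of operators -/

/-- The operator `f` is uniformly continuous w.r.t. `d`. -/
def IsUniformlyContinuous {S : Signature.{u}} (d : Proc S → Proc S → ℝ≥0∞) (f : S.Op) : Prop :=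
  ∀ ε : ℝ≥0∞, 0 < ε → ∃ δ : Fin (S.ar f) → ℝ≥0∞, (∀ i, 0 < δ i) ∧
    ∀ s t : Fin (S.ar f) → Proc S, (∀ i, d (s i) (t i) < δ i) →
      d (.app f s) (.app f t) < ε

/-- The operator `f` is `K`-Lipschitz continuous w.r.t. `d`. -/
def IsLipschitz {S : Signature.{u}} (d : Proc S → Proc S → ℝ≥0∞) (f : S.Op) (K : ℝ≥0) : Prop :=
  ∀ s t : Fin (S.ar f) → Proc S,
    d (.app f s) (.app f t) ≤ K * ∑ i, d (s i) (t i)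

/-! ### The copy operator -/

/-- The copy operator, the synchronous parallel composition it relies on, and the operators nil,
probabilistic prefix `a.([p₁]_ ⊕ … ⊕ [pₙ]_)` with positive weights, and alternative composition. -/
inductive CpOp (A : Type u) : Type u where
  | nil : CpOp A
  | pre (a : A) (n : ℕ) (p : PMF (Fin n)) (hp : ∀ i, p i ≠ 0) : CpOp A
  | alt : CpOp A
  | par : CpOp A
  | cp : CpOp A

def CpOp.ar {A : Type u} : CpOp A → ℕ
  | .nil => 0
  | .pre _ n _ _ => n
  | .alt => 2
  | .par => 2
  | .cp => 1

abbrev cpSignature (A : Type u) : Signature.{u} := ⟨CpOp A, CpOp.ar⟩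

section CpRules

variable {A : Type u}

/-- No premises; the target is `∑ i, p i • δ(x_i)`. -/
noncomputable def preRule (n : ℕ) (p : PMF (Fin n)) : Rule (cpSignature A) A n where
  numPos := 0
  posArg := Fin.elim0
  posLabel := Fin.elim0
  numNeg := 0
  negArg := Fin.elim0
  negLabel := Fin.elim0
  target := .sum (Fin n) p (fun i => .dirac (.var i))

/-- From `x_i ⟶[a] μ` infer a transition to `μ`. -/
def mimicRule {n : ℕ} (i : Fin n) (a : A) : Rule (cpSignature A) A n where
  numPos := 1
  posArg := fun _ => i
  posLabel := fun _ => a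
  numNeg := 0
  negArg := Fin.elim0
  negLabel := Fin.elim0
  target := .var 0

/-- From `x ⟶[a] μ` and `y ⟶[a] ν` infer a transition of `x | y` to `μ | ν`. -/
def syncRule (a : A) : Rule (cpSignature A) A 2 where
  numPos := 2
  posArg := ![0, 1]
  posLabel := fun _ => a
  numNeg := 0
  negArg := Fin.elim0
  negLabel := Fin.elim0
  target := .app CpOp.par (fun i : Fin 2 => .var i)

/-- From `x ⟶[√] μ` and `y ⟶[√] ν` infer a transition of `x | y` to `δ(0)`. -/
def terminateRule (tick : A) : Rule (cpSignature A) A 2 where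
  numPos := 2
  posArg := ![0, 1]
  posLabel := fun _ => tick
  numNeg := 0
  negArg := Fin.elim0
  negLabel := Fin.elim0
  target := .dirac (.app CpOp.nil (fun i : Fin 0 => i.elim0))

/-- From `x ⟶[l] μ` and `x ⟶[r] ν` infer a transition of `cp(x)` to `cp(μ) | cp(ν)`. -/
def forkRule (l r : A) : Rule (cpSignature A) A 1 where
  numPos := 2
  posArg := fun _ => 0
  posLabel := ![l, r]
  numNeg := 0
  negArg := Fin.elim0
  negLabel := Fin.elim0
  target := .app CpOp.par (fun i : Fin 2 => .app CpOp.cp (fun _ : Fin 1 => .var i))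

/-- The rules with successful termination action `tick`, left and right forking actions `l`, `r`,
and split action `s`. -/
def cpRules (tick l r s : A) : (f : CpOp A) → A → Set (Rule (cpSignature A) A f.ar)
  | .nil, _ => ∅
  | .pre b n p _, a => {ru | a = b ∧ ru = preRule n p}
  | .alt, a => {mimicRule (n := 2) 0 a, mimicRule (n := 2) 1 a}
  | .par, a => {ru | (a ≠ tick ∧ ru = syncRule a) ∨ (a = tick ∧ ru = terminateRule tick)}
  | .cp, a => {ru | (a ≠ l ∧ a ≠ r ∧ ru = mimicRule (n := 1) 0 a) ∨ (a = s ∧ ru = forkRule l r)}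

def cpSpec (tick l r s : A) : PTSS (cpSignature A) A where
  rules := cpRules tick l r s
  finite_rules := by
    intro f a
    cases f with
    | nil => exact Set.finite_empty
    | pre b n p hp => exact (Set.finite_singleton (preRule n p)).subset fun ru h => h.2
    | alt =>
      exact (Set.finite_singleton (mimicRule (n := 2) 1 a)).insert (mimicRule (n := 2) 0 a)
    | par =>
      refine ((Set.finite_singleton (terminateRule tick)).insert (syncRule a)).subset ?_
      rintro ru (h | h)
      · exact Or.inl h.2
      · exact Or.inr h.2
    | cp =>
      refine ((Set.finite_singleton (forkRule l r)).insert (mimicRule (n := 1) 0 a)).subset ?_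
      rintro ru (h | h)
      · exact Or.inl h.2.2
      · exact Or.inr h.2

end CpRules

end PGSOS

/-! Parts 1 and 2 rest on how `cp` and `|` act on one transition. Distances add up under parallel
composition (`upToMetric_parP_le`): independent couplings of the two components form a coupling of
the products. A transition of `cp(x)` either mimics one of `x` or leads to `cp(μ) | cp(ν)`, so each
unfolding at most doubles the Lipschitz constant. This gives `2 ^ k` for the up-to-`k` metric
(`upToMetric_cpP_le`).

For `lam < 1` the functional shrinks additive errors by `lam`, and image-finiteness makes the
supremum of the up-to-`k` metrics a bisimulation metric (`isBisimulationMetric_limMetric`). Hence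
the bisimilarity metric exceeds the up-to-`k` metric by at most `lam ^ k`, and uniform continuity
follows by choosing `k` first and `δ` afterwards.

For part 3, two processes with `n + 1` nested forks differ only in a branch of weight `p 1` at the
bottom, so their distance is at most `lam ^ (n + 1) * p 1`. Their copies run `2 ^ (n + 1)`
synchronised instances of the bottom choice: `n + 2` successive `s`-steps have probability `1` for
one copy and `p 0 ^ 2 ^ (n + 1)` for the other (`obs_cpP_forkSeq`). By `pow_mul_obs_le`, discounted
probabilities of this kind bound every bisimulation metric from below. With `p 1 = 1 / 2 ^ (n + 1)`
the copies are at least `lam ^ (n + 2) / 2` apart, so the ratio of distances is at least `lam * 2 ^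
n`, which is unbounded in `n`. -/

namespace PGSOS

/-! ### Expectations and the Kantorovich lifting -/

section Expect

variable {X : Type u} {Y : Type v} {Z : Type w}

/-- The expected value of `f` under `π`. -/
noncomputable def expect (π : PMF X) (f : X → ℝ≥0∞) : ℝ≥0∞ := ∑' x, f x * π x

theorem expect_bind (π : PMF X) (q : X → PMF Y) (f : Y → ℝ≥0∞) :
    expect (π.bind q) f = expect π fun x => expect (q x) f := by
  simp only [expect, PMF.bind_apply, ← ENNReal.tsum_mul_left, ← ENNReal.tsum_mul_right]
  rw [ENNReal.tsum_comm]
  exact tsum_congr fun x => tsum_congr fun y => by ring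

theorem expect_pure (x : X) (f : X → ℝ≥0∞) : expect (PMF.pure x) f = f x := by
  classical
  rw [expect, tsum_eq_single x]
  · simp
  · intro y hy
    simp [PMF.pure_apply, hy]

theorem expect_map (π : PMF X) (g : X → Y) (f : Y → ℝ≥0∞) :
    expect (π.map g) f = expect π fun x => f (g x) := by
  rw [← PMF.bind_pure_comp, expect_bind]
  simp only [Function.comp, expect_pure]

theorem expect_mono (π : PMF X) {f g : X → ℝ≥0∞} (h : ∀ x, f x ≤ g x) :
    expect π f ≤ expect π g :=
  ENNReal.tsum_le_tsum fun x => mul_le_mul_left (h x) _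

theorem expect_add (π : PMF X) (f g : X → ℝ≥0∞) :
    expect π (fun x => f x + g x) = expect π f + expect π g := by
  simp only [expect, add_mul, ENNReal.tsum_add]

theorem expect_const_mul (π : PMF X) (c : ℝ≥0∞) (f : X → ℝ≥0∞) :
    expect π (fun x => c * f x) = c * expect π f := by
  simp only [expect, mul_assoc, ENNReal.tsum_mul_left]

theorem expect_mul_const (π : PMF X) (c : ℝ≥0∞) (f : X → ℝ≥0∞) :
    expect π (fun x => f x * c) = expect π f * c := by
  simp only [mul_comm _ c, expect_const_mul]

theorem expect_const (π : PMF X) (c : ℝ≥0∞) : expect π (fun _ => c) = c := by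
  simp only [expect, ENNReal.tsum_mul_left, PMF.tsum_coe, mul_one]

/-- The image of the product distribution of `μ` and `ν` under `g`. -/
noncomputable def lift₂ (g : X → Y → Z) (μ : PMF X) (ν : PMF Y) : PMF Z :=
  μ.bind fun x => ν.map (g x)

theorem expect_lift₂ (g : X → Y → Z) (μ : PMF X) (ν : PMF Y) (f : Z → ℝ≥0∞) :
    expect (lift₂ g μ ν) f = expect μ fun x => expect ν fun y => f (g x y) := by
  simp only [lift₂, expect_bind, expect_map]

theorem kantorovich_le {d : X → X → ℝ≥0∞} {π π' : PMF X} {ω : PMF (X × X)}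
    (h : IsMatching π π' ω) : kantorovich d π π' ≤ expect ω fun x => d x.1 x.2 :=
  iInf₂_le ω h

theorem le_kantorovich {d : X → X → ℝ≥0∞} {π π' : PMF X} {c : ℝ≥0∞}
    (h : ∀ ω, IsMatching π π' ω → c ≤ expect ω fun x => d x.1 x.2) : c ≤ kantorovich d π π' :=
  le_iInf₂ h

theorem kantorovich_mono {d d' : X → X → ℝ≥0∞} (h : ∀ x y, d x y ≤ d' x y) (π π' : PMF X) :
    kantorovich d π π' ≤ kantorovich d' π π' :=
  le_kantorovich fun _ hω => (kantorovich_le hω).trans (expect_mono _ fun _ => h _ _)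

theorem kantorovich_le_add_const {d d' : X → X → ℝ≥0∞} {c : ℝ≥0∞}
    (h : ∀ x y, d x y ≤ d' x y + c) (π π' : PMF X) :
    kantorovich d π π' ≤ kantorovich d' π π' + c := by
  rw [← tsub_le_iff_right]
  refine le_kantorovich fun ω hω => ?_
  rw [tsub_le_iff_right]
  calc kantorovich d π π' ≤ expect ω fun x => d x.1 x.2 := kantorovich_le hω
    _ ≤ expect ω fun x => d' x.1 x.2 + c := expect_mono _ fun _ => h _ _
    _ = _ := by rw [expect_add, expect_const]

/-- The coupling draws a single index from `p` and uses it on both sides. -/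
theorem kantorovich_map_map_le {I : Type w} (d : X → X → ℝ≥0∞) (p : PMF I) (f g : I → X) :
    kantorovich d (p.map f) (p.map g) ≤ expect p fun i => d (f i) (g i) := by
  have h : IsMatching (p.map f) (p.map g) (p.map fun i => (f i, g i)) := by
    constructor <;> rw [PMF.map_comp] <;> rfl
  exact (kantorovich_le h).trans_eq (expect_map _ _ _)

theorem kantorovich_self {d : X → X → ℝ≥0∞} (h : ∀ x, d x x = 0) (π : PMF X) :
    kantorovich d π π = 0 := by
  have := kantorovich_map_map_le d π id id
  simpa only [PMF.map_id, id, h, expect_const, nonpos_iff_eq_zero] using this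

theorem IsMatching.lift₂ {μ μ' : PMF X} {ν ν' : PMF Y} {ω₁ : PMF (X × X)} {ω₂ : PMF (Y × Y)}
    (g : X → Y → Z) (h₁ : IsMatching μ μ' ω₁) (h₂ : IsMatching ν ν' ω₂) :
    IsMatching (lift₂ g μ ν) (lift₂ g μ' ν')
      (lift₂ (fun x y => (g x.1 y.1, g x.2 y.2)) ω₁ ω₂) := by
  obtain ⟨rfl, rfl⟩ := h₁
  obtain ⟨rfl, rfl⟩ := h₂
  constructor <;> simp only [PGSOS.lift₂, PMF.map_bind, PMF.bind_map, PMF.map_comp] <;> rfl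

/-- Couplings of the two components are combined independently. The case `c = 1` serves `|`, and `c
= 2 ^ k` serves the target of the fork rule. -/
theorem kantorovich_lift₂_le {d : X → X → ℝ≥0∞} {d' : Z → Z → ℝ≥0∞} {c : ℝ≥0∞}
    (hc₀ : c ≠ 0) (hc : c ≠ ∞) (g : X → X → Z)
    (h : ∀ x x' y y', d' (g x y) (g x' y') ≤ c * (d x x' + d y y')) (μ μ' ν ν' : PMF X) :
    kantorovich d' (lift₂ g μ ν) (lift₂ g μ' ν') ≤
      c * (kantorovich d μ μ' + kantorovich d ν ν') := by
  have key : ∀ ω₁, IsMatching μ μ' ω₁ → ∀ ω₂, IsMatching ν ν' ω₂ →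
      kantorovich d' (lift₂ g μ ν) (lift₂ g μ' ν') ≤
        c * ((expect ω₁ fun x => d x.1 x.2) + expect ω₂ fun y => d y.1 y.2) := by
    intro ω₁ h₁ ω₂ h₂
    refine (kantorovich_le (h₁.lift₂ g h₂)).trans ?_
    rw [expect_lift₂]
    calc _ ≤ expect ω₁ fun x => expect ω₂ fun y => c * (d x.1 x.2 + d y.1 y.2) :=
          expect_mono _ fun x => expect_mono _ fun y => h _ _ _ _
      _ = _ := by simp only [expect_const_mul, expect_add, expect_const]
  -- With `c` on the other side, the right-hand side is a bare sum of two infima, which can be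
  -- bounded coupling by coupling.
  rw [mul_comm, ← ENNReal.div_le_iff hc₀ hc]
  refine ENNReal.le_iInf₂_add_iInf₂ fun ω₁ h₁ ω₂ h₂ => ?_
  rw [ENNReal.div_le_iff hc₀ hc, mul_comm]
  exact key ω₁ h₁ ω₂ h₂

/-- Couplings with a common marginal can be glued. -/
theorem exists_glue {π₁ π₂ π₃ : PMF X} {ω₁ ω₂ : PMF (X × X)} (h₁ : IsMatching π₁ π₂ ω₁)
    (h₂ : IsMatching π₂ π₃ ω₂) :
    ∃ τ : PMF (X × X × X), τ.map (fun q => (q.1, q.2.1)) = ω₁ ∧ τ.map Prod.snd = ω₂ := by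
  classical
  have hmarg : ∀ y, π₂ y = ∑' z, ω₂ (y, z) := by
    intro y
    rw [← h₂.1, PMF.map_apply, ENNReal.tsum_prod']
    rw [tsum_eq_single y]
    · simp
    · intro x hx
      simp [Ne.symm hx]
  have hfin : ∀ y, ∑' z, ω₂ (y, z) ≠ ∞ := fun y => by rw [← hmarg]; exact PMF.apply_ne_top _ _
  -- The conditional law under `ω₂` of the second coordinate given the first; where `π₂` vanishes
  -- its value is irrelevant.
  let κ : X → PMF X := fun y =>
    if h : ∑' z, ω₂ (y, z) = 0 then PMF.pure y else PMF.normalize (fun z => ω₂ (y, z)) h (hfin y)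
  have hκ : ∀ y z, π₂ y * κ y z = ω₂ (y, z) := by
    intro y z
    by_cases h : ∑' z, ω₂ (y, z) = 0
    · rw [hmarg, h, zero_mul, ENNReal.tsum_eq_zero.1 h z]
    · simp only [κ, dif_neg h, PMF.normalize_apply, hmarg]
      rw [mul_comm, mul_assoc, ENNReal.inv_mul_cancel h (hfin y), mul_one]
  refine ⟨ω₁.bind fun q => (κ q.2).map fun z => (q.1, q.2, z), ?_, ?_⟩
  · simp only [PMF.map_bind, PMF.map_comp]
    refine Eq.trans ?_ (PMF.bind_pure ω₁)
    congr 1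
    funext q
    exact PMF.map_const (κ q.2) q
  · have : (ω₁.bind fun q => (κ q.2).map fun z => (q.1, q.2, z)).map Prod.snd =
        (ω₁.map Prod.snd).bind fun y => (κ y).map fun z => (y, z) := by
      simp only [PMF.map_bind, PMF.bind_map, PMF.map_comp]
      rfl
    rw [this, h₁.2]
    ext ⟨y, z⟩
    rw [PMF.bind_apply, tsum_eq_single y, PMF.map_apply, tsum_eq_single z, if_pos rfl, hκ]
    · intro z' hz
      rw [if_neg]
      rintro ⟨⟩
      exact hz rfl
    · intro y' hy
      rw [PMF.map_apply, ENNReal.tsum_eq_zero.2, mul_zero]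
      intro z'
      rw [if_neg]
      rintro ⟨⟩
      exact hy rfl

theorem kantorovich_triangle {d : X → X → ℝ≥0∞} (h : ∀ x y z, d x z ≤ d x y + d y z)
    (π₁ π₂ π₃ : PMF X) :
    kantorovich d π₁ π₃ ≤ kantorovich d π₁ π₂ + kantorovich d π₂ π₃ := by
  have key : ∀ ω₁, IsMatching π₁ π₂ ω₁ → ∀ ω₂, IsMatching π₂ π₃ ω₂ →
      kantorovich d π₁ π₃ ≤ (expect ω₁ fun x => d x.1 x.2) + expect ω₂ fun y => d y.1 y.2 := by
    intro ω₁ h₁ ω₂ h₂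
    obtain ⟨τ, rfl, rfl⟩ := exists_glue h₁ h₂
    have hm : IsMatching π₁ π₃ (τ.map fun q => (q.1, q.2.2)) := by
      refine ⟨?_, ?_⟩
      · rw [← h₁.1, PMF.map_comp, PMF.map_comp]; rfl
      · rw [← h₂.2, PMF.map_comp, PMF.map_comp]; rfl
    refine (kantorovich_le hm).trans ?_
    simp only [expect_map, ← expect_add]
    exact expect_mono _ fun q => h _ _ _
  exact ENNReal.le_iInf₂_add_iInf₂ key

end Expect

/-! ### Bisimulation metrics of image-finite systems -/

section Bisimulation

variable {S : Signature.{u}} {A : Type v} (P : PTSS S A) (lam : ℝ≥0)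

/-- The induced model is image-finite. -/
theorem PTSS.finite_der (t : Proc S) (a : A) : (P.der t a).Finite := by
  induction t generalizing a with
  | var x => exact x.elim
  | app f ts ih =>
    have hsub : P.der (.app f ts) a ⊆ ⋃ r ∈ P.rules f a, (fun ρ => r.target.eval ts ρ) ''
        Set.univ.pi fun k => P.der (ts (r.posArg k)) (r.posLabel k) := by
      rintro π ⟨r, hr, ρ, hpos, -, rfl⟩
      exact Set.mem_biUnion hr ⟨ρ, fun k _ => hpos k, rfl⟩
    exact ((P.finite_rules f a).biUnion fun r _ =>
      (Set.Finite.pi fun k => ih (r.posArg k) (r.posLabel k)).image _).subset hsub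

theorem bisimFunctional_symm (d : Proc S → Proc S → ℝ≥0∞) (t t' : Proc S) :
    bisimFunctional P lam d t t' = bisimFunctional P lam d t' t :=
  iSup_congr fun _ => max_comm _ _

theorem bisimFunctional_le_one (d : Proc S → Proc S → ℝ≥0∞) (t t' : Proc S) :
    bisimFunctional P lam d t t' ≤ 1 :=
  iSup_le fun _ => max_le (iSup₂_le fun _ _ => min_le_left _ _)
    (iSup₂_le fun _ _ => min_le_left _ _)

variable {P lam}

/-- Bounds `c ≥ 1` hold trivially, so only the transfer condition for `c < 1` remains, as in the
definition of bisimulation metrics. -/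
theorem bisimFunctional_le {d : Proc S → Proc S → ℝ≥0∞} {t t' : Proc S} {c : ℝ≥0∞}
    (h : c < 1 → ∀ a π, P.step t a π → ∃ π', P.step t' a π' ∧ lam * kantorovich d π π' ≤ c)
    (h' : c < 1 → ∀ a π, P.step t' a π → ∃ π', P.step t a π' ∧ lam * kantorovich d π π' ≤ c) :
    bisimFunctional P lam d t t' ≤ c := by
  rcases le_or_gt 1 c with hc | hc
  · exact (bisimFunctional_le_one P lam d t t').trans hc
  · refine iSup_le fun a => max_le (iSup₂_le fun π hπ => ?_) (iSup₂_le fun π hπ => ?_)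
    · obtain ⟨π', hπ', hle⟩ := h hc a π hπ
      exact (min_le_right _ _).trans ((iInf₂_le π' hπ').trans hle)
    · obtain ⟨π', hπ', hle⟩ := h' hc a π hπ
      exact (min_le_right _ _).trans ((iInf₂_le π' hπ').trans hle)

/-- A value below `1` deactivates the cap in the Hausdorff lifting and excludes an empty set of
derivatives; image-finiteness then makes the infimum a minimum. -/
theorem exists_step_of_bisimFunctional_lt_one {d : Proc S → Proc S → ℝ≥0∞} {t t' : Proc S}
    (h : bisimFunctional P lam d t t' < 1) {a : A} {π : PMF (Proc S)} (hπ : P.step t a π) :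
    ∃ π', P.step t' a π' ∧ lam * kantorovich d π π' ≤ bisimFunctional P lam d t t' := by
  have hle : min 1 (⨅ π' ∈ P.der t' a, (lam : ℝ≥0∞) * kantorovich d π π') ≤
      bisimFunctional P lam d t t' :=
    le_iSup_of_le a (le_max_of_le_left (le_iSup₂_of_le (f := fun π (_ : π ∈ P.der t a) =>
      min 1 (⨅ π' ∈ P.der t' a, (lam : ℝ≥0∞) * kantorovich d π π')) π hπ le_rfl))
  have hlt : (⨅ π' ∈ P.der t' a, (lam : ℝ≥0∞) * kantorovich d π π') < 1 := by
    rcases min_lt_iff.1 (hle.trans_lt h) with h1 | h1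
    · exact absurd h1 (lt_irrefl _)
    · exact h1
  rw [min_eq_right hlt.le] at hle
  have hne : (P.der t' a).Nonempty := by
    by_contra hne
    rw [Set.not_nonempty_iff_eq_empty] at hne
    simp [hne] at hlt
  obtain ⟨π', hπ', hmin⟩ := (P.finite_der t' a).exists_minimalFor
    (fun π' => (lam : ℝ≥0∞) * kantorovich d π π') _ hne
  refine ⟨π', hπ', (le_iInf₂ fun π'' h'' => ?_).trans hle⟩
  rcases le_total (lam * kantorovich d π π') (lam * kantorovich d π π'') with h1 | h1
  · exact h1
  · exact hmin h'' h1

theorem bisimFunctional_mono {d d' : Proc S → Proc S → ℝ≥0∞} (h : ∀ t t', d t t' ≤ d' t t')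
    (t t' : Proc S) : bisimFunctional P lam d t t' ≤ bisimFunctional P lam d' t t' := by
  have key : ∀ t t', bisimFunctional P lam d' t t' < 1 → ∀ a π, P.step t a π →
      ∃ π', P.step t' a π' ∧ lam * kantorovich d π π' ≤ bisimFunctional P lam d' t t' := by
    intro t t' hlt a π hπ
    obtain ⟨π', hπ', hle⟩ := exists_step_of_bisimFunctional_lt_one hlt hπ
    exact ⟨π', hπ', (mul_le_mul_right (kantorovich_mono h _ _) _).trans hle⟩
  refine bisimFunctional_le (key t t') ?_
  rw [bisimFunctional_symm]
  exact key t' t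

/-- The contraction property behind the geometric rate of convergence: a constant passes unchanged
through the Kantorovich lifting and is then scaled by `lam`. -/
theorem bisimFunctional_le_add_const {d d' : Proc S → Proc S → ℝ≥0∞} {c : ℝ≥0∞}
    (h : ∀ t t', d t t' ≤ d' t t' + c) (t t' : Proc S) :
    bisimFunctional P lam d t t' ≤ bisimFunctional P lam d' t t' + lam * c := by
  have key : ∀ t t', bisimFunctional P lam d' t t' + lam * c < 1 → ∀ a π, P.step t a π →
      ∃ π', P.step t' a π' ∧
        lam * kantorovich d π π' ≤ bisimFunctional P lam d' t t' + lam * c := by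
    intro t t' hlt a π hπ
    obtain ⟨π', hπ', hle⟩ :=
      exists_step_of_bisimFunctional_lt_one (le_self_add.trans_lt hlt) hπ
    refine ⟨π', hπ', (mul_le_mul_right (kantorovich_le_add_const h _ _) _).trans ?_⟩
    rw [mul_add]
    exact add_le_add_left hle _
  refine bisimFunctional_le (key t t') ?_
  rw [bisimFunctional_symm]
  exact key t' t

theorem IsPseudometric.bisimFunctional {d : Proc S → Proc S → ℝ≥0∞} (hd : IsPseudometric d) :
    IsPseudometric (bisimFunctional P lam d) where
  le_one := bisimFunctional_le_one P lam d
  refl t := by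
    have key : (0 : ℝ≥0∞) < 1 → ∀ a π, P.step t a π →
        ∃ π', P.step t a π' ∧ lam * kantorovich d π π' ≤ 0 := fun _ a π hπ =>
      ⟨π, hπ, by rw [kantorovich_self hd.refl, mul_zero]⟩
    exact nonpos_iff_eq_zero.1 (bisimFunctional_le key key)
  symm := bisimFunctional_symm P lam d
  triangle x y z := by
    have key : ∀ x y z, PGSOS.bisimFunctional P lam d x y + PGSOS.bisimFunctional P lam d y z < 1 →
        ∀ a π, P.step x a π → ∃ π', P.step z a π' ∧ lam * kantorovich d π π' ≤
          PGSOS.bisimFunctional P lam d x y + PGSOS.bisimFunctional P lam d y z := by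
      intro x y z hlt a π hπ
      obtain ⟨π', hπ', h1⟩ :=
        exists_step_of_bisimFunctional_lt_one (le_self_add.trans_lt hlt) hπ
      obtain ⟨π'', hπ'', h2⟩ :=
        exists_step_of_bisimFunctional_lt_one (le_add_self.trans_lt hlt) hπ'
      refine ⟨π'', hπ'', (mul_le_mul_right (kantorovich_triangle hd.triangle π π' π'') _).trans ?_⟩
      rw [mul_add]
      exact add_le_add h1 h2
    refine bisimFunctional_le (key x y z) ?_
    have := key z y x
    rwa [bisimFunctional_symm P lam d z y, bisimFunctional_symm P lam d y x, add_comm] at this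

variable (P lam)

theorem upToMetric_zero (t t' : Proc S) : upToMetric P lam 0 t t' = 0 := rfl

theorem upToMetric_succ (k : ℕ) :
    upToMetric P lam (k + 1) = bisimFunctional P lam (upToMetric P lam k) :=
  Function.iterate_succ_apply' _ _ _

theorem isPseudometric_upToMetric (k : ℕ) : IsPseudometric (upToMetric P lam k) := by
  induction k with
  | zero => exact ⟨by simp [upToMetric_zero], by simp [upToMetric_zero], by simp [upToMetric_zero],
      by simp [upToMetric_zero]⟩
  | succ k ih => rw [upToMetric_succ]; exact ih.bisimFunctional

theorem upToMetric_le_succ (k : ℕ) (t t' : Proc S) :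
    upToMetric P lam k t t' ≤ upToMetric P lam (k + 1) t t' := by
  induction k generalizing t t' with
  | zero => exact zero_le
  | succ k ih =>
    rw [upToMetric_succ, upToMetric_succ P lam (k + 1)]
    exact bisimFunctional_mono ih t t'

theorem monotone_upToMetric (t t' : Proc S) : Monotone fun k => upToMetric P lam k t t' :=
  monotone_nat_of_le_succ fun k => upToMetric_le_succ P lam k t t'

/-- The iterations started from the zero function and from the up-to-`m` metric begin at most `1`
apart, and each round contracts the gap by `lam`. -/
theorem upToMetric_le_add_pow (k m : ℕ) (t t' : Proc S) :
    upToMetric P lam (k + m) t t' ≤ upToMetric P lam k t t' + (lam : ℝ≥0∞) ^ k := by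
  induction k generalizing t t' with
  | zero => simpa using le_add_left ((isPseudometric_upToMetric P lam _).le_one t t')
  | succ k ih =>
    rw [Nat.add_right_comm, upToMetric_succ, upToMetric_succ, pow_succ']
    exact bisimFunctional_le_add_const ih t t'

/-- The supremum of the up-to-`k` bisimilarity metrics. -/
noncomputable def limMetric (t t' : Proc S) : ℝ≥0∞ := ⨆ k, upToMetric P lam k t t'

theorem upToMetric_le_limMetric (k : ℕ) (t t' : Proc S) :
    upToMetric P lam k t t' ≤ limMetric P lam t t' :=
  le_iSup (fun k => upToMetric P lam k t t') k

theorem limMetric_le_add_pow (k : ℕ) (t t' : Proc S) :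
    limMetric P lam t t' ≤ upToMetric P lam k t t' + (lam : ℝ≥0∞) ^ k :=
  iSup_le fun m => (monotone_upToMetric P lam t t' (Nat.le_add_left m k)).trans
    (upToMetric_le_add_pow P lam k m t t')

theorem isPseudometric_limMetric : IsPseudometric (limMetric P lam) where
  le_one t t' := iSup_le fun k => (isPseudometric_upToMetric P lam k).le_one t t'
  refl t := by simp [limMetric, (isPseudometric_upToMetric P lam _).refl]
  symm t t' := iSup_congr fun k => (isPseudometric_upToMetric P lam k).symm t t'
  triangle x y z := iSup_le fun k => ((isPseudometric_upToMetric P lam k).triangle x y z).trans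
    (add_le_add (upToMetric_le_limMetric P lam k x y) (upToMetric_le_limMetric P lam k y z))

variable {lam}

/-- Each up-to-`k` metric yields a matching derivative, possibly depending on `k`. There are
finitely many candidates, so one serves infinitely many `k`, hence all `k` by monotonicity. Uniform
convergence at rate `lam ^ k` carries the bound to the limit. -/
theorem isBisimulationMetric_limMetric (hlam : lam < 1) :
    IsBisimulationMetric P lam (limMetric P lam) where
  isPseudometric := isPseudometric_limMetric P lam
  transfer t t' hlt a π hπ := by
    have hex : ∀ k, ∃ π' : P.der t' a,
        lam * kantorovich (upToMetric P lam k) π π' ≤ limMetric P lam t t' := by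
      intro k
      have hk := upToMetric_le_limMetric P lam (k + 1) t t'
      rw [upToMetric_succ] at hk
      obtain ⟨π', hπ', hle⟩ := exists_step_of_bisimFunctional_lt_one (hk.trans_lt hlt) hπ
      exact ⟨⟨π', hπ'⟩, hle.trans hk⟩
    choose q hq using hex
    have : Finite (P.der t' a) := P.finite_der t' a
    obtain ⟨π', hinf⟩ := Finite.exists_infinite_fiber q
    have hall : ∀ k, lam * kantorovich (upToMetric P lam k) π π' ≤ limMetric P lam t t' := by
      intro k
      obtain ⟨m, hm, hkm⟩ := (Set.infinite_coe_iff.1 hinf).exists_gt k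
      have : q m = π' := hm
      rw [← this]
      exact (mul_le_mul_right (kantorovich_mono
        (fun x y => monotone_upToMetric P lam x y hkm.le) _ _) _).trans (hq m)
    refine ⟨π', π'.2, ?_⟩
    have hpow : Filter.Tendsto (fun k : ℕ => limMetric P lam t t' + (lam : ℝ≥0∞) ^ (k + 1))
        Filter.atTop (nhds (limMetric P lam t t' + 0)) :=
      ((ENNReal.tendsto_pow_atTop_nhds_zero_of_lt_one (by exact_mod_cast hlam)).comp
        (Filter.tendsto_add_atTop_nat 1)).const_add _
    rw [add_zero] at hpow
    refine ge_of_tendsto' hpow fun k => ?_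
    calc lam * kantorovich (limMetric P lam) π π'
        ≤ lam * (kantorovich (upToMetric P lam k) π π' + (lam : ℝ≥0∞) ^ k) :=
          mul_le_mul_right (kantorovich_le_add_const (limMetric_le_add_pow P lam k) _ _) _
      _ ≤ _ := by
          rw [mul_add, pow_succ']
          exact add_le_add_left (hall k) _

theorem bisimilarityMetric_le {d : Proc S → Proc S → ℝ≥0∞} (hd : IsBisimulationMetric P lam d)
    (t t' : Proc S) : bisimilarityMetric P lam t t' ≤ d t t' :=
  sInf_le (α := Proc S → Proc S → ℝ≥0∞) hd t t'

theorem le_bisimilarityMetric {t t' : Proc S} {c : ℝ≥0∞}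
    (h : ∀ d, IsBisimulationMetric P lam d → c ≤ d t t') :
    c ≤ bisimilarityMetric P lam t t' := by
  simp only [bisimilarityMetric, sInf_apply, iInf_apply]
  exact le_iInf fun d => h d d.2

/-- A bisimulation metric is a pre-fixed point of the monotone functional, so it dominates every
iterate from zero. -/
theorem IsBisimulationMetric.upToMetric_le {d : Proc S → Proc S → ℝ≥0∞}
    (hd : IsBisimulationMetric P lam d) (k : ℕ) (t t' : Proc S) :
    upToMetric P lam k t t' ≤ d t t' := by
  induction k generalizing t t' with
  | zero => exact zero_le
  | succ k ih =>
    rw [upToMetric_succ]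
    have key : ∀ t t', d t t' < 1 → ∀ a π, P.step t a π →
        ∃ π', P.step t' a π' ∧ lam * kantorovich (upToMetric P lam k) π π' ≤ d t t' := by
      intro t t' hlt a π hπ
      obtain ⟨π', hπ', hle⟩ := hd.transfer t t' hlt a π hπ
      exact ⟨π', hπ', (mul_le_mul_right (kantorovich_mono ih _ _) _).trans hle⟩
    refine bisimFunctional_le (key t t') ?_
    rw [hd.isPseudometric.symm t t']
    exact key t' t

theorem upToMetric_le_bisimilarityMetric (k : ℕ) (t t' : Proc S) :
    upToMetric P lam k t t' ≤ bisimilarityMetric P lam t t' :=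
  le_bisimilarityMetric P fun _ hd => hd.upToMetric_le P k t t'

theorem bisimilarityMetric_le_add_pow (hlam : lam < 1) (k : ℕ) (t t' : Proc S) :
    bisimilarityMetric P lam t t' ≤ upToMetric P lam k t t' + (lam : ℝ≥0∞) ^ k :=
  (bisimilarityMetric_le P (isBisimulationMetric_limMetric P hlam) t t').trans
    (limMetric_le_add_pow P lam k t t')

end Bisimulation

/-! ### The transitions of the operators of the copy calculus -/

section Transitions

variable {A : Type u} {S : Signature.{v}} (e : (cpSignature A).Embedding S)

/-- The process with head operator `e.toFun f` and arguments `ts`. -/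
def opTerm (f : CpOp A) (ts : Fin f.ar → Proc S) : Proc S :=
  .app (e.toFun f) fun i => ts (Fin.cast (e.ar_eq f) i)

theorem opTerm_inj {f : CpOp A} {ts ts' : Fin f.ar → Proc S} (h : opTerm e f ts = opTerm e f ts') :
    ts = ts' := by
  simp only [opTerm, Term.app.injEq, heq_eq_eq, true_and] at h
  funext i
  exact congrFun h (Fin.cast (e.ar_eq f).symm i)

/-- The stopped process. -/
def nilP : Proc S := opTerm e .nil Fin.elim0

/-- Alternative composition of processes. -/
def altP (x y : Proc S) : Proc S := opTerm e .alt ![x, y]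

/-- Synchronous parallel composition of processes. -/
def parP (x y : Proc S) : Proc S := opTerm e .par ![x, y]

/-- The copy operator on processes. -/
def cpP (x : Proc S) : Proc S := opTerm e .cp fun _ => x

/-- The rank of an embedded operator equals the original rank only propositionally; this moves the
cast out of the product so that the formulas for ranks one and two apply. -/
theorem prodPMF_cast {X : Type v} {Y : Type w} {m n : ℕ} (h : m = n) (π : Fin n → PMF X)
    (g : (Fin m → X) → Y) :
    (prodPMF m fun i => π (Fin.cast h i)).map g =
      (prodPMF n π).map fun x => g fun i => x (Fin.cast h i) := by
  subst h
  rfl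

theorem prodPMF_one_map {X : Type v} {Y : Type w} (π : Fin 1 → PMF X) (g : (Fin 1 → X) → Y) :
    (prodPMF 1 π).map g = (π 0).map fun x => g fun _ => x := by
  simp only [prodPMF, PMF.map_bind, PMF.pure_map]
  rw [← PMF.bind_pure_comp]
  congr 1
  funext x
  simp only [Function.comp]
  congr 2
  funext i
  exact Fin.cases rfl (fun j => j.elim0) i

theorem prodPMF_two_map {X : Type v} {Y : Type w} (π : Fin 2 → PMF X) (g : (Fin 2 → X) → Y) :
    (prodPMF 2 π).map g = lift₂ (fun x y => g ![x, y]) (π 0) (π 1) := by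
  rw [prodPMF, PMF.map_bind, lift₂]
  congr 1
  funext x
  rw [PMF.map_comp, prodPMF_one_map]
  congr 1
  funext y
  simp only [Function.comp]
  congr 1
  funext i
  fin_cases i <;> rfl

variable {e} {tick l r s : A} {P : PTSS S A}
  (hP : IsDisjointExtension e (cpSpec tick l r s) P)
include hP

/-- Disjointness leaves only the rules of the copy calculus for these operators, although the
arguments are arbitrary processes of the extension. -/
theorem step_opTerm_iff {f : CpOp A} {ts : Fin f.ar → Proc S} {a : A} {π : PMF (Proc S)} :
    P.step (opTerm e f ts) a π ↔ ∃ ru ∈ cpRules tick l r s f a,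
      ∃ ρ : Fin ru.numPos → PMF (Proc S),
        (∀ k, P.step (ts (ru.posArg k)) (ru.posLabel k) (ρ k)) ∧
        (∀ j, ∀ π', ¬ P.step (ts (ru.negArg j)) (ru.negLabel j) π') ∧
        π = (ru.target.map e (Fin.cast (e.ar_eq f).symm)).eval
          (fun i => ts (Fin.cast (e.ar_eq f) i)) ρ := by
  have : P.step (opTerm e f ts) a π ↔ ∃ ru ∈ P.rules (e.toFun f) a,
      ru.Derives (fun i => ts (Fin.cast (e.ar_eq f) i))
        (fun i => P.step (ts (Fin.cast (e.ar_eq f) i))) π := Iff.rfl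
  rw [this, hP f a, Set.exists_mem_image]
  rfl

theorem not_step_nilP {a : A} {π : PMF (Proc S)} : ¬ P.step (nilP e) a π := by
  intro h
  obtain ⟨ru, hru, -⟩ := (step_opTerm_iff hP).1 h
  exact hru

theorem step_pre_iff {b : A} {n : ℕ} {p : PMF (Fin n)} {hp : ∀ i, p i ≠ 0}
    {ts : Fin n → Proc S} {a : A} {π : PMF (Proc S)} :
    P.step (opTerm e (.pre b n p hp) ts) a π ↔ a = b ∧ π = p.map ts := by
  refine (step_opTerm_iff hP).trans ?_
  have htgt : ∀ ρ, ((preRule (A := A) n p).target.map e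
      (Fin.cast (e.ar_eq (.pre b n p hp)).symm)).eval
      (fun i => ts (Fin.cast (e.ar_eq (.pre b n p hp)) i)) ρ = p.map ts := fun ρ =>
    PMF.bind_pure_comp _ _
  constructor
  · rintro ⟨ru, ⟨rfl, rfl⟩, ρ, -, -, rfl⟩
    exact ⟨rfl, htgt ρ⟩
  · rintro ⟨rfl, rfl⟩
    exact ⟨_, ⟨rfl, rfl⟩, Fin.elim0, fun k => k.elim0, fun k => k.elim0, (htgt _).symm⟩

theorem step_altP_iff {x y : Proc S} {a : A} {π : PMF (Proc S)} :
    P.step (altP e x y) a π ↔ P.step x a π ∨ P.step y a π := by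
  refine (step_opTerm_iff hP).trans ?_
  constructor
  · rintro ⟨ru, rfl | rfl, ρ, h, -, rfl⟩
    · exact Or.inl (h (0 : Fin 1))
    · exact Or.inr (h (0 : Fin 1))
  · rintro (h | h)
    · exact ⟨_, Or.inl rfl, fun _ => π, fun _ => h, fun k => k.elim0, rfl⟩
    · exact ⟨_, Or.inr rfl, fun _ => π, fun _ => h, fun k => k.elim0, rfl⟩

theorem step_parP_iff {x y : Proc S} {a : A} {π : PMF (Proc S)} :
    P.step (parP e x y) a π ↔ ∃ μ ν, P.step x a μ ∧ P.step y a ν ∧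
      ((a ≠ tick ∧ π = lift₂ (parP e) μ ν) ∨ (a = tick ∧ π = PMF.pure (nilP e))) := by
  have hsync : ∀ b (σ : Fin (S.ar (e.toFun CpOp.par)) → Proc S) (ρ : Fin 2 → PMF (Proc S)),
      ((syncRule b).target.map e (Fin.cast (e.ar_eq .par).symm)).eval σ ρ =
        lift₂ (parP e) (ρ 0) (ρ 1) := fun b σ ρ =>
    (prodPMF_cast (e.ar_eq .par) ρ _).trans (prodPMF_two_map _ _)
  have hterm : ∀ (σ : Fin (S.ar (e.toFun CpOp.par)) → Proc S) (ρ : Fin 2 → PMF (Proc S)),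
      ((terminateRule tick).target.map e (Fin.cast (e.ar_eq .par).symm)).eval σ ρ =
        PMF.pure (nilP e) := by
    intro σ ρ
    refine congrArg PMF.pure (congrArg (Term.app _) ?_)
    funext i
    exact (Fin.cast (e.ar_eq .nil) i).elim0
  refine (step_opTerm_iff hP).trans ?_
  constructor
  · rintro ⟨ru, ⟨ha, rfl⟩ | ⟨rfl, rfl⟩, ρ, h, -, rfl⟩
    · exact ⟨ρ (0 : Fin 2), ρ (1 : Fin 2), h (0 : Fin 2), h (1 : Fin 2), Or.inl ⟨ha, hsync _ _ _⟩⟩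
    · exact ⟨ρ (0 : Fin 2), ρ (1 : Fin 2), h (0 : Fin 2), h (1 : Fin 2), Or.inr ⟨rfl, hterm _ _⟩⟩
  · rintro ⟨μ, ν, hμ, hν, ⟨ha, rfl⟩ | ⟨rfl, rfl⟩⟩
    · refine ⟨syncRule a, Or.inl ⟨ha, rfl⟩, ![μ, ν], ?_, fun k => k.elim0,
        (hsync a _ ![μ, ν]).symm⟩
      exact Fin.forall_fin_two.2 ⟨hμ, hν⟩
    · refine ⟨terminateRule a, Or.inr ⟨rfl, rfl⟩, ![μ, ν], ?_, fun k => k.elim0, (hterm _ _).symm⟩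
      exact Fin.forall_fin_two.2 ⟨hμ, hν⟩

theorem step_cpP_iff {x : Proc S} {a : A} {π : PMF (Proc S)} :
    P.step (cpP e x) a π ↔ (a ≠ l ∧ a ≠ r ∧ P.step x a π) ∨
      (a = s ∧ ∃ μ ν, P.step x l μ ∧ P.step x r ν ∧
        π = lift₂ (fun y z => parP e (cpP e y) (cpP e z)) μ ν) := by
  have hfork : ∀ (σ : Fin (S.ar (e.toFun CpOp.cp)) → Proc S) (ρ : Fin 2 → PMF (Proc S)),
      ((forkRule l r).target.map e (Fin.cast (e.ar_eq .cp).symm)).eval σ ρ =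
        lift₂ (fun y z => parP e (cpP e y) (cpP e z)) (ρ 0) (ρ 1) := by
    intro σ ρ
    have h1 : ∀ i : Fin 2, ((DTerm.app (S := cpSignature A) CpOp.cp
        (fun _ : Fin 1 => DTerm.var (V := Fin 1) i)).map e
          (Fin.cast (e.ar_eq .cp).symm)).eval σ ρ = (ρ i).map (cpP e) := fun i =>
      (prodPMF_cast (e.ar_eq .cp) (fun _ => ρ i) _).trans (prodPMF_one_map _ _)
    refine ((prodPMF_cast (e.ar_eq .par) (fun i : Fin 2 => ((DTerm.app (S := cpSignature A)
        CpOp.cp (fun _ : Fin 1 => DTerm.var (V := Fin 1) i)).map e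
          (Fin.cast (e.ar_eq .cp).symm)).eval σ ρ) _).trans (prodPMF_two_map _ _)).trans ?_
    rw [h1, h1]
    simp only [lift₂, PMF.bind_map, PMF.map_comp]
    rfl
  refine (step_opTerm_iff hP).trans ?_
  constructor
  · rintro ⟨ru, ⟨hl, hr, rfl⟩ | ⟨rfl, rfl⟩, ρ, h, -, rfl⟩
    · exact Or.inl ⟨hl, hr, h (0 : Fin 1)⟩
    · exact Or.inr ⟨rfl, ρ (0 : Fin 2), ρ (1 : Fin 2), h (0 : Fin 2), h (1 : Fin 2), hfork _ _⟩
  · rintro (⟨hl, hr, h⟩ | ⟨rfl, μ, ν, hμ, hν, rfl⟩)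
    · exact ⟨_, Or.inl ⟨hl, hr, rfl⟩, fun _ => π, fun _ => h, fun k => k.elim0, rfl⟩
    · refine ⟨forkRule l r, Or.inr ⟨rfl, rfl⟩, ![μ, ν], ?_, fun k => k.elim0,
        (hfork (fun _ => x) ![μ, ν]).symm⟩
      exact Fin.forall_fin_two.2 ⟨hμ, hν⟩

end Transitions

/-! ### Continuity of the copy operator -/

section Continuity

variable {A : Type u} {S : Signature.{v}} {e : (cpSignature A).Embedding S} {tick l r s : A}
  {P : PTSS S A} (hP : IsDisjointExtension e (cpSpec tick l r s) P) (lam : ℝ≥0)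
include hP

/-- A synchronised step is matched componentwise, and the two costs add up. After a `tick` step both
sides are `δ(0)`, at distance zero. -/
theorem upToMetric_parP_le (k : ℕ) (x x' y y' : Proc S) :
    upToMetric P lam k (parP e x y) (parP e x' y') ≤
      upToMetric P lam k x x' + upToMetric P lam k y y' := by
  induction k generalizing x x' y y' with
  | zero => exact zero_le
  | succ k ih =>
    have hd := isPseudometric_upToMetric P lam k
    have hd' := isPseudometric_upToMetric P lam (k + 1)
    rw [upToMetric_succ] at hd' ⊢
    generalize hB : bisimFunctional P lam (upToMetric P lam k) = B at *
    have key : ∀ x x' y y', B x x' + B y y' < 1 → ∀ a π, P.step (parP e x y) a π →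
        ∃ π', P.step (parP e x' y') a π' ∧
          lam * kantorovich (upToMetric P lam k) π π' ≤ B x x' + B y y' := by
      subst hB
      intro x x' y y' hlt a π hπ
      obtain ⟨μ, ν, hμ, hν, hor⟩ := (step_parP_iff hP).1 hπ
      obtain ⟨μ', hμ', h1⟩ :=
        exists_step_of_bisimFunctional_lt_one (le_self_add.trans_lt hlt) hμ
      obtain ⟨ν', hν', h2⟩ :=
        exists_step_of_bisimFunctional_lt_one (le_add_self.trans_lt hlt) hν
      rcases hor with ⟨ha, rfl⟩ | ⟨ha, rfl⟩
      · refine ⟨_, (step_parP_iff hP).2 ⟨μ', ν', hμ', hν', Or.inl ⟨ha, rfl⟩⟩, ?_⟩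
        have := kantorovich_lift₂_le one_ne_zero ENNReal.one_ne_top (parP e)
          (fun x x' y y' => (ih x x' y y').trans_eq (one_mul _).symm) μ μ' ν ν'
        rw [one_mul] at this
        refine (mul_le_mul_right this _).trans ?_
        rw [mul_add]
        exact add_le_add h1 h2
      · refine ⟨_, (step_parP_iff hP).2 ⟨μ', ν', hμ', hν', Or.inr ⟨ha, rfl⟩⟩, ?_⟩
        rw [kantorovich_self hd.refl, mul_zero]
        exact zero_le
    subst hB
    refine bisimFunctional_le (key x x' y y') ?_
    rw [hd'.symm x x', hd'.symm y y']
    exact key x' x y' y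

/-- The fork rule uses the argument twice, and the resulting two copies contribute additively under
`|`; this is the factor `2` per unfolding. Mimicking steps only need the constant to be at least
`1`. -/
theorem upToMetric_cpP_le (k : ℕ) (x x' : Proc S) :
    upToMetric P lam k (cpP e x) (cpP e x') ≤ 2 ^ k * upToMetric P lam k x x' := by
  induction k generalizing x x' with
  | zero => exact zero_le
  | succ k ih =>
    rw [upToMetric_succ]
    have hone : (1 : ℝ≥0∞) ≤ 2 ^ (k + 1) := one_le_pow_of_one_le' one_le_two _
    have key : ∀ x x', 2 ^ (k + 1) * bisimFunctional P lam (upToMetric P lam k) x x' < 1 →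
        ∀ a π, P.step (cpP e x) a π → ∃ π', P.step (cpP e x') a π' ∧
          lam * kantorovich (upToMetric P lam k) π π' ≤
            2 ^ (k + 1) * bisimFunctional P lam (upToMetric P lam k) x x' := by
      intro x x' hlt a π hπ
      have hle := le_mul_of_one_le_left
        (zero_le (a := bisimFunctional P lam (upToMetric P lam k) x x')) hone
      rcases (step_cpP_iff hP).1 hπ with ⟨hl, hr, hπ⟩ | ⟨ha, μ, ν, hμ, hν, rfl⟩
      · obtain ⟨π', hπ', h⟩ := exists_step_of_bisimFunctional_lt_one (hle.trans_lt hlt) hπ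
        exact ⟨π', (step_cpP_iff hP).2 (Or.inl ⟨hl, hr, hπ'⟩), h.trans hle⟩
      · obtain ⟨μ', hμ', h1⟩ := exists_step_of_bisimFunctional_lt_one (hle.trans_lt hlt) hμ
        obtain ⟨ν', hν', h2⟩ := exists_step_of_bisimFunctional_lt_one (hle.trans_lt hlt) hν
        refine ⟨_, (step_cpP_iff hP).2 (Or.inr ⟨ha, μ', ν', hμ', hν', rfl⟩), ?_⟩
        have h := kantorovich_lift₂_le (c := 2 ^ k) (pow_ne_zero _ two_ne_zero)
          (ENNReal.pow_ne_top ENNReal.ofNat_ne_top)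
          (d := upToMetric P lam k) (d' := upToMetric P lam k)
          (fun y z => parP e (cpP e y) (cpP e z))
          (fun y y' z z' => (upToMetric_parP_le hP lam k _ _ _ _).trans
            ((add_le_add (ih y y') (ih z z')).trans_eq (mul_add _ _ _).symm)) μ μ' ν ν'
        refine (mul_le_mul_right h _).trans ?_
        rw [mul_left_comm, mul_add, pow_succ, mul_assoc, two_mul]
        exact mul_le_mul_right (add_le_add h1 h2) _
    refine bisimFunctional_le (key x x') ?_
    rw [bisimFunctional_symm]
    exact key x' x

theorem isLipschitz_upToMetric_cp (k : ℕ) :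
    IsLipschitz (upToMetric P lam k) (e.toFun CpOp.cp) (2 ^ k) := by
  intro x y
  have har : S.ar (e.toFun CpOp.cp) = 1 := e.ar_eq .cp
  have hx : ∀ ts : Fin (S.ar (e.toFun CpOp.cp)) → Proc S,
      Term.app (e.toFun CpOp.cp) ts = cpP e (ts (Fin.cast har.symm 0)) := by
    intro ts
    refine congrArg (Term.app _) ?_
    funext i
    congr 1
    apply Fin.ext
    simp
    omega
  rw [hx, hx]
  push_cast
  refine (upToMetric_cpP_le hP lam k _ _).trans (mul_le_mul_right ?_ _)
  exact Finset.single_le_sum (f := fun i => upToMetric P lam k (x i) (y i))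
    (fun i _ => zero_le) (Finset.mem_univ _)

theorem isUniformlyContinuous_bisimilarityMetric_cp (hlam : lam < 1) :
    IsUniformlyContinuous (bisimilarityMetric P lam) (e.toFun CpOp.cp) := by
  intro ε hε
  -- The strict inequality at the end needs `ε / 2` finite; for infinite `ε` the bound by `1`
  -- suffices.
  rcases eq_or_ne ε ∞ with rfl | hε'
  · exact ⟨fun _ => 1, fun _ => one_pos, fun x y _ => ((bisimilarityMetric_le P
      (isBisimulationMetric_limMetric P hlam) _ _).trans
        ((isPseudometric_limMetric P lam).le_one _ _)).trans_lt ENNReal.one_lt_top⟩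
  have har : S.ar (e.toFun CpOp.cp) = 1 := e.ar_eq .cp
  obtain ⟨k, hk⟩ : ∃ k : ℕ, (lam : ℝ≥0∞) ^ k < ε / 2 :=
    (((ENNReal.tendsto_pow_atTop_nhds_zero_of_lt_one (by exact_mod_cast hlam)).eventually
      (gt_mem_nhds (ENNReal.half_pos hε.ne'))).exists)
  have h2 : (2 : ℝ≥0∞) ^ k ≠ 0 := pow_ne_zero _ two_ne_zero
  have h2' : (2 : ℝ≥0∞) ^ k ≠ ∞ := ENNReal.pow_ne_top ENNReal.ofNat_ne_top
  -- One half of `ε` pays for the tail `lam ^ k`; the other is divided by the Lipschitz constant `2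
  -- ^ k`.
  refine ⟨fun _ => ε / 2 / 2 ^ k, fun _ => ENNReal.div_pos (ENNReal.half_pos hε.ne').ne' h2', ?_⟩
  intro x y hxy
  have hsum : ∑ i, upToMetric P lam k (x i) (y i) ≤ ε / 2 / 2 ^ k := by
    have : ∀ i, upToMetric P lam k (x i) (y i) ≤ ε / 2 / 2 ^ k := fun i =>
      (upToMetric_le_bisimilarityMetric P k _ _).trans (hxy i).le
    refine (Finset.sum_le_card_nsmul _ _ _ fun i _ => this i).trans_eq ?_
    rw [Finset.card_univ, Fintype.card_fin, har, one_smul]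
  have hlip := isLipschitz_upToMetric_cp hP lam k x y
  push_cast at hlip
  calc bisimilarityMetric P lam (.app (e.toFun CpOp.cp) x) (.app (e.toFun CpOp.cp) y)
      ≤ upToMetric P lam k (.app (e.toFun CpOp.cp) x) (.app (e.toFun CpOp.cp) y) + lam ^ k :=
        bisimilarityMetric_le_add_pow P hlam k _ _
    _ ≤ 2 ^ k * (ε / 2 / 2 ^ k) + lam ^ k :=
        add_le_add_left (hlip.trans (mul_le_mul_right hsum _)) _
    _ = ε / 2 + lam ^ k := by rw [ENNReal.mul_div_cancel h2 h2']
    _ < ε := ?_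
  calc ε / 2 + lam ^ k < ε / 2 + ε / 2 :=
        ENNReal.add_lt_add_left (ENNReal.div_ne_top hε' two_ne_zero) hk
    _ = ε := ENNReal.add_halves ε

end Continuity

/-! ### Lower bounds by observations -/

section Observation

variable {S : Signature.{u}} {A : Type v} (P : PTSS S A) (s : A)

/-- The maximal probability of performing `m` successive `s`-labelled transitions. -/
noncomputable def obs : ℕ → Proc S → ℝ≥0∞
  | 0, _ => 1
  | m + 1, t => ⨆ (π : PMF (Proc S)) (_ : P.step t s π), expect π (obs m)

theorem obs_le_one (m : ℕ) (t : Proc S) : obs P s m t ≤ 1 := by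
  induction m generalizing t with
  | zero => exact le_rfl
  | succ m ih =>
    exact iSup₂_le fun π _ => (expect_mono π ih).trans_eq (expect_const π 1)

/-- The easy half of Kantorovich duality, obtained by integrating the hypothesis against a coupling.
-/
theorem expect_le_expect_add_kantorovich {X : Type u} {d : X → X → ℝ≥0∞} {f : X → ℝ≥0∞}
    (h : ∀ x y, f x ≤ f y + d x y) (π π' : PMF X) :
    expect π f ≤ expect π' f + kantorovich d π π' := by
  rw [← tsub_le_iff_left]
  refine le_kantorovich fun ω hω => ?_
  rw [tsub_le_iff_left, ← hω.1, ← hω.2, expect_map, expect_map, ← expect_add]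
  exact expect_mono _ fun q => h _ _

/-- The discounted observation is nonexpansive: every transition costs one factor `lam`, which is
the factor in the transfer condition. -/
theorem pow_mul_obs_le {lam : ℝ≥0} (hlam : lam ≤ 1) {d : Proc S → Proc S → ℝ≥0∞}
    (hd : IsBisimulationMetric P lam d) (m : ℕ) (t t' : Proc S) :
    (lam : ℝ≥0∞) ^ m * obs P s m t ≤ (lam : ℝ≥0∞) ^ m * obs P s m t' + d t t' := by
  induction m generalizing t t' with
  | zero => exact le_self_add
  | succ m ih =>
    rcases le_or_gt 1 (d t t') with h1 | h1
    · refine le_add_left (le_trans ?_ h1)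
      exact mul_le_one' (pow_le_one' (by exact_mod_cast hlam) _) (obs_le_one P s _ _)
    · simp only [obs]
      rw [ENNReal.mul_iSup]
      refine iSup_le fun π => ?_
      rw [ENNReal.mul_iSup]
      refine iSup_le fun hπ => ?_
      obtain ⟨π', hπ', hle⟩ := hd.transfer t t' h1 s π hπ
      have hE := expect_le_expect_add_kantorovich ih π π'
      rw [expect_const_mul, expect_const_mul] at hE
      calc (lam : ℝ≥0∞) ^ (m + 1) * expect π (obs P s m)
          = lam * (lam ^ m * expect π (obs P s m)) := by ring
        _ ≤ lam * (lam ^ m * expect π' (obs P s m) + kantorovich d π π') :=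
            mul_le_mul_right hE _
        _ = lam ^ (m + 1) * expect π' (obs P s m) + lam * kantorovich d π π' := by ring
        _ ≤ _ := add_le_add (mul_le_mul_right (le_iSup₂_of_le (f := fun π (_ : P.step t' s π) =>
            expect π (obs P s m)) π' hπ' le_rfl) _) hle

end Observation

/-! ### A metric that relates the points of two sequences -/

section PairMetric

variable {X : Type u} (Z : Bool → ℕ → X) (c : ℕ → ℝ≥0∞)

open Classical in
/-- The distance that is `c n` between the `n`-th points of two sequences and `1` between all other
pairs of different points. -/
noncomputable def pairMetric (x y : X) : ℝ≥0∞ :=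
  if x = y then 0 else min 1 (⨅ (b : Bool) (n : ℕ) (_ : x = Z b n ∧ y = Z (!b) n), c n)

theorem pairMetric_self (x : X) : pairMetric Z c x x = 0 := if_pos rfl

theorem pairMetric_le_one (x y : X) : pairMetric Z c x y ≤ 1 := by
  unfold pairMetric
  split_ifs
  · exact zero_le
  · exact min_le_left _ _

theorem pairMetric_pair_le (b : Bool) (n : ℕ) : pairMetric Z c (Z b n) (Z (!b) n) ≤ c n := by
  unfold pairMetric
  split_ifs
  · exact zero_le
  · exact (min_le_right _ _).trans
      (iInf_le_of_le b (iInf_le_of_le n (iInf_le_of_le ⟨rfl, rfl⟩ le_rfl)))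

variable {Z c}

theorem exists_of_pairMetric_lt_one {x y : X} (hne : x ≠ y) (h : pairMetric Z c x y < 1) :
    ∃ b n, x = Z b n ∧ y = Z (!b) n := by
  by_contra hcon
  simp only [not_exists] at hcon
  simp [pairMetric, hne, hcon] at h

theorem le_pairMetric_pair (hZ : ∀ b n b' n', Z b n = Z b' n' → b = b' ∧ n = n') {n : ℕ}
    (hc : c n ≤ 1) (b : Bool) : c n ≤ pairMetric Z c (Z b n) (Z (!b) n) := by
  have hne : Z b n ≠ Z (!b) n := fun h => by simpa using (hZ _ _ _ _ h).1
  rw [pairMetric, if_neg hne]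
  refine le_min hc (le_iInf fun b' => le_iInf fun n' => le_iInf fun h => ?_)
  rw [(hZ _ _ _ _ h.1).2]

/-- Distinct points at distance below `1` are partners, and injectivity gives each point at most one
partner. Two such steps in a row therefore return to the start, which settles the triangle
inequality. -/
theorem isPseudometric_pairMetric (hZ : ∀ b n b' n', Z b n = Z b' n' → b = b' ∧ n = n') :
    IsPseudometric (pairMetric Z c) where
  le_one := pairMetric_le_one Z c
  refl := pairMetric_self Z c
  symm := by
    have key : ∀ x y, pairMetric Z c x y ≤ pairMetric Z c y x := by
      intro x y
      rcases eq_or_ne x y with rfl | hne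
      · exact le_rfl
      · rw [pairMetric, pairMetric, if_neg hne, if_neg hne.symm]
        refine min_le_min_left _ (le_iInf fun b => le_iInf fun n => le_iInf fun h => ?_)
        exact iInf_le_of_le (!b) (iInf_le_of_le n
          (iInf_le_of_le ⟨h.2, by rw [Bool.not_not]; exact h.1⟩ le_rfl))
    exact fun x y => le_antisymm (key x y) (key y x)
  triangle x y z := by
    rcases eq_or_ne x y with rfl | hxy
    · rw [pairMetric_self, zero_add]
    rcases eq_or_ne y z with rfl | hyz
    · rw [pairMetric_self, add_zero]
    rcases le_or_gt 1 (pairMetric Z c x y) with h1 | h1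
    · exact (pairMetric_le_one Z c x z).trans (h1.trans le_self_add)
    rcases le_or_gt 1 (pairMetric Z c y z) with h2 | h2
    · exact (pairMetric_le_one Z c x z).trans (h2.trans le_add_self)
    obtain ⟨b, n, rfl, rfl⟩ := exists_of_pairMetric_lt_one hxy h1
    obtain ⟨b', n', h, rfl⟩ := exists_of_pairMetric_lt_one hyz h2
    obtain ⟨rfl, rfl⟩ := hZ _ _ _ _ h
    rw [Bool.not_not, pairMetric_self]
    exact zero_le

end PairMetric

/-! ### The copy operator is not Lipschitz continuous -/

section Fork

variable {A : Type u} {S : Signature.{v}} (e : (cpSignature A).Embedding S) (l r : A)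
  (p : PMF (Fin 2)) (hp : ∀ i, p i ≠ 0)

/-- The process `l.([p₀]x ⊕ [p₁]y) + r.([p₀]x ⊕ [p₁]y)`. -/
def forkP (x y : Proc S) : Proc S :=
  altP e (opTerm e (.pre l 2 p hp) ![x, y]) (opTerm e (.pre r 2 p hp) ![x, y])

/-- The process `forkP (forkP 0 0) y` under `n` further forks, where `y` is `0` or `forkP 0 0`. -/
def forkSeq (b : Bool) : ℕ → Proc S
  | 0 => forkP e l r p hp (forkP e l r p hp (nilP e) (nilP e))
      (bif b then nilP e else forkP e l r p hp (nilP e) (nilP e))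
  | n + 1 => forkP e l r p hp (forkSeq b n) (forkSeq b n)

theorem forkP_inj {x y x' y' : Proc S} (h : forkP e l r p hp x y = forkP e l r p hp x' y') :
    x = x' ∧ y = y' := by
  have h1 := congrFun (opTerm_inj e h) (0 : Fin 2)
  have h2 := opTerm_inj e h1
  exact ⟨congrFun h2 (0 : Fin 2), congrFun h2 (1 : Fin 2)⟩

theorem nilP_ne_forkP (x y : Proc S) : nilP e ≠ forkP e l r p hp x y := by
  intro h
  simp only [nilP, forkP, altP, opTerm, Term.app.injEq] at h
  cases e.injective h.1

theorem forkSeq_eq_forkP (b : Bool) (n : ℕ) :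
    ∃ x y z, forkSeq e l r p hp b n = forkP e l r p hp (forkP e l r p hp x y) z := by
  cases n with
  | zero => exact ⟨_, _, _, rfl⟩
  | succ n => cases n <;> exact ⟨_, _, _, rfl⟩

/-- Separates the bottom level from the others in `forkSeq_inj`: the left argument at level zero is
a fork of `0`, whereas every `forkSeq` has a fork as its own left argument. -/
theorem forkP_nilP_ne_forkSeq (x : Proc S) (b : Bool) (n : ℕ) :
    forkP e l r p hp (nilP e) x ≠ forkSeq e l r p hp b n := by
  obtain ⟨y, z, w, h⟩ := forkSeq_eq_forkP e l r p hp b n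
  rw [h]
  exact fun h => nilP_ne_forkP e l r p hp _ _ (forkP_inj e l r p hp h).1

theorem forkSeq_inj (b : Bool) (n : ℕ) (b' : Bool) (n' : ℕ)
    (h : forkSeq e l r p hp b n = forkSeq e l r p hp b' n') : b = b' ∧ n = n' := by
  induction n generalizing n' with
  | zero =>
    cases n' with
    | zero =>
      refine ⟨?_, rfl⟩
      have h2 := (forkP_inj e l r p hp h).2
      cases b <;> cases b'
      · rfl
      · exact absurd h2.symm (nilP_ne_forkP e l r p hp _ _)
      · exact absurd h2 (nilP_ne_forkP e l r p hp _ _)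
      · rfl
    | succ n' => exact absurd (forkP_inj e l r p hp h).1 (forkP_nilP_ne_forkSeq e l r p hp _ _ _)
  | succ n ih =>
    cases n' with
    | zero =>
      exact absurd (forkP_inj e l r p hp h).1.symm (forkP_nilP_ne_forkSeq e l r p hp _ _ _)
    | succ n' =>
      obtain ⟨rfl, rfl⟩ := ih n' (forkP_inj e l r p hp h).1
      exact ⟨rfl, rfl⟩

theorem expect_fin_two (f : Fin 2 → ℝ≥0∞) : expect p f = f 0 * p 0 + f 1 * p 1 := by
  rw [expect, tsum_fintype, Fin.sum_univ_two]

variable {e} {l r} {tick s : A} {P : PTSS S A}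
  (hP : IsDisjointExtension e (cpSpec tick l r s) P)
include hP

theorem step_forkP_iff {x y : Proc S} {a : A} {π : PMF (Proc S)} :
    P.step (forkP e l r p hp x y) a π ↔ (a = l ∨ a = r) ∧ π = p.map ![x, y] := by
  refine (step_altP_iff hP).trans ((or_congr (step_pre_iff hP) (step_pre_iff hP)).trans ?_)
  exact or_and_right.symm

/-- Partners are matched branch by branch. At level zero only the branch of weight `p 1` differs, at
cost at most `lam * p 1`; at higher levels both branches are partners one level below, so only a
factor `lam` is added. -/
theorem isBisimulationMetric_forkSeq {lam : ℝ≥0} (hlam : lam ≤ 1) :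
    IsBisimulationMetric P lam
      (pairMetric (forkSeq e l r p hp) fun n => (lam : ℝ≥0∞) ^ (n + 1) * p 1) where
  isPseudometric := isPseudometric_pairMetric (forkSeq_inj e l r p hp)
  transfer t t' hlt a π hπ := by
    rcases eq_or_ne t t' with rfl | hne
    · exact ⟨π, hπ, by rw [kantorovich_self (pairMetric_self _ _), mul_zero]; exact zero_le⟩
    obtain ⟨b, n, rfl, rfl⟩ := exists_of_pairMetric_lt_one hne hlt
    have hc : (lam : ℝ≥0∞) ^ (n + 1) * p 1 ≤ 1 :=
      mul_le_one' (pow_le_one' (by exact_mod_cast hlam) _) (p.coe_le_one _)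
    suffices h : ∃ π', P.step (forkSeq e l r p hp (!b) n) a π' ∧ lam * kantorovich
        (pairMetric (forkSeq e l r p hp) fun n => (lam : ℝ≥0∞) ^ (n + 1) * p 1) π π' ≤
          (lam : ℝ≥0∞) ^ (n + 1) * p 1 by
      obtain ⟨π', hπ', hle⟩ := h
      exact ⟨π', hπ', hle.trans (le_pairMetric_pair (c := fun n => (lam : ℝ≥0∞) ^ (n + 1) * p 1)
        (forkSeq_inj e l r p hp) hc b)⟩
    cases n with
    | zero =>
      obtain ⟨ha, rfl⟩ := (step_forkP_iff p hp hP).1 hπ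
      refine ⟨_, (step_forkP_iff p hp hP).2 ⟨ha, rfl⟩, ?_⟩
      rw [zero_add, pow_one]
      refine mul_le_mul_right ((kantorovich_map_map_le _ p _ _).trans ?_) _
      rw [expect_fin_two]
      simp only [Matrix.cons_val_zero, Matrix.cons_val_one, pairMetric_self, zero_mul, zero_add]
      exact mul_le_of_le_one_left zero_le (pairMetric_le_one _ _ _ _)
    | succ n =>
      obtain ⟨ha, rfl⟩ := (step_forkP_iff p hp hP).1 hπ
      refine ⟨_, (step_forkP_iff p hp hP).2 ⟨ha, rfl⟩, ?_⟩
      rw [pow_succ', mul_assoc]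
      refine mul_le_mul_right ((kantorovich_map_map_le _ p _ _).trans ?_) _
      refine (expect_mono p fun i => ?_).trans_eq (expect_const p _)
      have := pairMetric_pair_le (forkSeq e l r p hp)
        (fun n => (lam : ℝ≥0∞) ^ (n + 1) * p 1) b n
      fin_cases i <;> exact this

theorem bisimilarityMetric_forkSeq_le {lam : ℝ≥0} (hlam : lam ≤ 1) (n : ℕ) :
    bisimilarityMetric P lam (forkSeq e l r p hp false n) (forkSeq e l r p hp true n) ≤
      (lam : ℝ≥0∞) ^ (n + 1) * p 1 :=
  (bisimilarityMetric_le P (isBisimulationMetric_forkSeq p hp hP hlam) _ _).trans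
    (pairMetric_pair_le _ _ false n)

/-- The components move in lockstep but choose independently, so probabilities multiply. For `s =
tick` the parallel composition would stop after one step. -/
theorem obs_parP (hs : s ≠ tick) (m : ℕ) (x y : Proc S) :
    obs P s m (parP e x y) = obs P s m x * obs P s m y := by
  induction m generalizing x y with
  | zero => exact (one_mul 1).symm
  | succ m ih =>
    have hE : ∀ μ ν, expect (lift₂ (parP e) μ ν) (obs P s m) =
        expect μ (obs P s m) * expect ν (obs P s m) := by
      intro μ ν
      rw [expect_lift₂]
      simp only [ih, expect_const_mul, expect_mul_const]
    apply le_antisymm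
    · refine iSup₂_le fun π hπ => ?_
      obtain ⟨μ, ν, hμ, hν, ⟨-, rfl⟩ | ⟨h, -⟩⟩ := (step_parP_iff hP).1 hπ
      · rw [hE]
        exact mul_le_mul'
          (le_iSup₂_of_le (f := fun π (_ : P.step x s π) => expect π (obs P s m)) μ hμ le_rfl)
          (le_iSup₂_of_le (f := fun π (_ : P.step y s π) => expect π (obs P s m)) ν hν le_rfl)
      · exact absurd h hs
    · simp only [obs, ENNReal.iSup_mul, ENNReal.mul_iSup]
      refine iSup₂_le fun ν hν => iSup₂_le fun μ hμ => ?_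
      rw [← hE]
      exact le_iSup₂_of_le (f := fun π (_ : P.step (parP e x y) s π) => expect π (obs P s m))
        _ ((step_parP_iff hP).2 ⟨μ, ν, hμ, hν, Or.inl ⟨hs, rfl⟩⟩) le_rfl

theorem obs_cpP_nilP (m : ℕ) : obs P s (m + 1) (cpP e (nilP e)) = 0 := by
  refine nonpos_iff_eq_zero.1 (iSup₂_le fun π hπ => ?_)
  rcases (step_cpP_iff hP).1 hπ with ⟨-, -, h⟩ | ⟨-, _, _, h, -⟩ <;>
    exact absurd h (not_step_nilP hP)

/-- The `l`- and `r`-branches carry the same distribution, so the split yields two independent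
samples; hence the square. -/
theorem obs_cpP_forkP (hs : s ≠ tick) (m : ℕ) (x y : Proc S) :
    obs P s (m + 1) (cpP e (forkP e l r p hp x y)) =
      (obs P s m (cpP e x) * p 0 + obs P s m (cpP e y) * p 1) ^ 2 := by
  have hE : expect (lift₂ (fun y z => parP e (cpP e y) (cpP e z)) (p.map ![x, y])
      (p.map ![x, y])) (obs P s m) =
        (obs P s m (cpP e x) * p 0 + obs P s m (cpP e y) * p 1) ^ 2 := by
    rw [expect_lift₂]
    simp only [obs_parP hP hs, expect_const_mul, expect_mul_const, expect_map, expect_fin_two,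
      Matrix.cons_val_zero, Matrix.cons_val_one]
    rw [sq]
  apply le_antisymm
  · refine iSup₂_le fun π hπ => ?_
    rcases (step_cpP_iff hP).1 hπ with ⟨hl, hr, h⟩ | ⟨-, μ, ν, hμ, hν, rfl⟩
    · exact absurd ((step_forkP_iff p hp hP).1 h).1 (not_or.2 ⟨hl, hr⟩)
    · rw [((step_forkP_iff p hp hP).1 hμ).2, ((step_forkP_iff p hp hP).1 hν).2, hE]
  · rw [← hE]
    exact le_iSup₂_of_le (f := fun π (_ : P.step (cpP e (forkP e l r p hp x y)) s π) =>
      expect π (obs P s m)) _ ((step_cpP_iff hP).2 (Or.inr ⟨rfl, _, _,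
        (step_forkP_iff p hp hP).2 ⟨Or.inl rfl, rfl⟩,
        (step_forkP_iff p hp hP).2 ⟨Or.inr rfl, rfl⟩, rfl⟩)) le_rfl

theorem obs_cpP_forkSeq (hs : s ≠ tick) (b : Bool) (n : ℕ) :
    obs P s (n + 2) (cpP e (forkSeq e l r p hp b n)) = (bif b then p 0 else 1) ^ 2 ^ (n + 1) := by
  have hp1 : p 0 + p 1 = 1 := by
    have := p.tsum_coe
    rwa [tsum_fintype, Fin.sum_univ_two] at this
  induction n with
  | zero =>
    have h0 : ∀ x, obs P s 0 x = 1 := fun _ => rfl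
    -- The copy of a fork of `0` can do one more `s`-step and the copy of `0` none. The `n + 2`
    -- steps are thus the `n + 1` nested splits followed by this test.
    have hu : obs P s 1 (cpP e (forkP e l r p hp (nilP e) (nilP e))) = 1 := by
      rw [obs_cpP_forkP p hp hP hs, h0, one_mul, one_mul, hp1, one_pow]
    rw [forkSeq, obs_cpP_forkP p hp hP hs, zero_add, hu, one_mul]
    cases b
    · rw [cond_false, hu, one_mul, hp1, cond_false, one_pow, one_pow]
    · rw [cond_true, obs_cpP_nilP hP 0, zero_mul, add_zero, cond_true, pow_one]
  | succ n ih =>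
    rw [forkSeq, obs_cpP_forkP p hp hP hs, ih, ← mul_add, hp1, mul_one, ← pow_mul, ← pow_succ]

/-- The bound is proved for every bisimulation metric and passes to the infimum, so `lam = 1` needs
no separate treatment. -/
theorem pow_le_bisimilarityMetric_cpP_forkSeq (hs : s ≠ tick) {lam : ℝ≥0} (hlam : lam ≤ 1)
    (n : ℕ) :
    (lam : ℝ≥0∞) ^ (n + 2) ≤ lam ^ (n + 2) * p 0 ^ 2 ^ (n + 1) +
      bisimilarityMetric P lam (cpP e (forkSeq e l r p hp false n))
        (cpP e (forkSeq e l r p hp true n)) := by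
  rw [← tsub_le_iff_left]
  refine le_bisimilarityMetric P fun d hd => ?_
  have := pow_mul_obs_le P s hlam hd (n + 2) (cpP e (forkSeq e l r p hp false n))
    (cpP e (forkSeq e l r p hp true n))
  rw [obs_cpP_forkSeq p hp hP hs, obs_cpP_forkSeq p hp hP hs] at this
  rwa [cond_false, cond_true, one_pow, mul_one, ← tsub_le_iff_left] at this

end Fork

/-- There is a distribution with weights `1 - 1 / N` and `1 / N`. -/
theorem exists_pmf_fin_two (N : ℕ) (hN : 2 ≤ N) : ∃ p : PMF (Fin 2), (∀ i, p i ≠ 0) ∧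
    p 0 ^ N ≤ ((1 / 2 : ℝ≥0) : ℝ≥0∞) ∧ p 1 = ((1 / N : ℝ≥0) : ℝ≥0∞) := by
  have hN' : (2 : ℝ≥0) ≤ N := by exact_mod_cast hN
  have hN0 : (0 : ℝ≥0) < N := two_pos.trans_le hN'
  have hlt : (1 / N : ℝ≥0) < 1 := by
    rw [div_lt_one hN0]
    exact one_lt_two.trans_le hN'
  refine ⟨PMF.ofFintype (fun i => ((![1 - 1 / N, 1 / N] : Fin 2 → ℝ≥0) i : ℝ≥0∞)) ?_, ?_, ?_, ?_⟩
  · rw [Fin.sum_univ_two]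
    simp only [Matrix.cons_val_zero, Matrix.cons_val_one]
    rw [← ENNReal.coe_add, tsub_add_cancel_of_le hlt.le, ENNReal.coe_one]
  · intro i
    rw [PMF.ofFintype_apply, ENNReal.coe_ne_zero]
    fin_cases i
    · exact (tsub_pos_of_lt hlt).ne'
    · exact (div_pos one_pos hN0).ne'
  · rw [PMF.ofFintype_apply, ← ENNReal.coe_pow, ENNReal.coe_le_coe, ← NNReal.coe_le_coe]
    simp only [Matrix.cons_val_zero]
    push_cast [NNReal.coe_sub hlt.le]
    -- The bound `1 / 2` comes from `(1 - 1 / N) ^ N ≤ exp (-1)` and `2 ≤ exp 1`.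
    have h1 : (1 - 1 / (N : ℝ)) ^ N ≤ Real.exp (-1) :=
      Real.one_sub_div_pow_le_exp_neg (by exact_mod_cast (by omega : 1 ≤ N))
    refine h1.trans ?_
    rw [Real.exp_neg, one_div]
    exact inv_anti₀ two_pos (by linarith [Real.add_one_le_exp (1 : ℝ)])
  · rw [PMF.ofFintype_apply]
    rfl

theorem not_isLipschitz_bisimilarityMetric_cp {A : Type u} {S : Signature.{v}}
    {e : (cpSignature A).Embedding S} {tick l r s : A} {P : PTSS S A}
    (hP : IsDisjointExtension e (cpSpec tick l r s) P) (hs : s ≠ tick) {lam : ℝ≥0}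
    (hpos : 0 < lam) (hlam : lam ≤ 1) (K : ℝ≥0) :
    ¬ IsLipschitz (bisimilarityMetric P lam) (e.toFun CpOp.cp) K := by
  intro hK
  have har : S.ar (e.toFun CpOp.cp) = 1 := e.ar_eq .cp
  have hlip : ∀ x y, bisimilarityMetric P lam (cpP e x) (cpP e y) ≤
      K * bisimilarityMetric P lam x y := by
    intro x y
    refine (hK (fun _ => x) (fun _ => y)).trans_eq ?_
    rw [Finset.sum_const, Finset.card_univ, Fintype.card_fin, har, one_smul]
  -- The distances have ratio at least `lam * 2 ^ n`, so `2 ^ n > K / lam` contradicts the constant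
  -- `K`.
  obtain ⟨n, hn⟩ := pow_unbounded_of_one_lt (K / lam) (one_lt_two (α := ℝ≥0))
  obtain ⟨p, hp, hp0, hp1⟩ := exists_pmf_fin_two (2 ^ (n + 1))
    (by rw [pow_succ]; exact Nat.le_mul_of_pos_left 2 (Nat.two_pow_pos n))
  have h : (lam : ℝ≥0∞) ^ (n + 2) ≤ lam ^ (n + 2) * ((1 / 2 : ℝ≥0) : ℝ≥0∞) +
      K * (lam ^ (n + 1) * ((1 / (2 ^ (n + 1) : ℕ) : ℝ≥0) : ℝ≥0∞)) :=
    (pow_le_bisimilarityMetric_cpP_forkSeq p hp hP hs hlam n).trans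
      (add_le_add (mul_le_mul_right hp0 _) ((hlip _ _).trans (mul_le_mul_right
        ((bisimilarityMetric_forkSeq_le p hp hP hlam n).trans_eq (by rw [hp1])) _)))
  have h' : lam ^ (n + 2) ≤ lam ^ (n + 2) * (1 / 2) +
      K * (lam ^ (n + 1) * (1 / (2 ^ (n + 1) : ℕ))) := by exact_mod_cast h
  rw [div_lt_iff₀ hpos] at hn
  rw [← NNReal.coe_le_coe] at h'
  rw [← NNReal.coe_lt_coe] at hn
  push_cast at h' hn
  have hpos' : (0 : ℝ) < lam := hpos
  have hL : (0 : ℝ) < (lam : ℝ) ^ (n + 1) := pow_pos hpos' _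
  have h2 : (0 : ℝ) < 2 ^ n := by positivity
  have h3 : (lam : ℝ) ^ (n + 2) = lam ^ (n + 1) * lam := pow_succ _ _
  have h4 : (lam : ℝ) ^ (n + 1) * lam ≤
      lam ^ (n + 1) * (lam * (1 / 2) + K * (1 / 2 ^ (n + 1))) := by
    rw [h3] at h'
    linarith
  have h5 := le_of_mul_le_mul_left h4 hL
  have h6 : (K : ℝ) * (1 / 2 ^ (n + 1)) < lam * (1 / 2) := by
    rw [pow_succ, mul_one_div, div_lt_iff₀ (by positivity)]
    linarith
  linarith

end PGSOS

theorem mainTheorem11 {A : Type u} (tick l r s : A) {S : PGSOS.Signature.{v}}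
    (P : PGSOS.PTSS S A) (e : (PGSOS.cpSignature A).Embedding S)
    (hP : PGSOS.IsDisjointExtension e (PGSOS.cpSpec tick l r s) P) :
    (∀ lam : ℝ≥0, 0 < lam → lam < 1 →
      PGSOS.IsUniformlyContinuous (PGSOS.bisimilarityMetric P lam) (e.toFun PGSOS.CpOp.cp)) ∧
    (∀ lam : ℝ≥0, 0 < lam → lam ≤ 1 → ∀ k : ℕ,
      PGSOS.IsLipschitz (PGSOS.upToMetric P lam k) (e.toFun PGSOS.CpOp.cp) (2 ^ k)) ∧
    (s ≠ tick → ∀ lam : ℝ≥0, 0 < lam → lam ≤ 1 →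
      ¬ ∃ K : ℝ≥0,
        PGSOS.IsLipschitz (PGSOS.bisimilarityMetric P lam) (e.toFun PGSOS.CpOp.cp) K) :=
  ⟨fun lam _ hlam => PGSOS.isUniformlyContinuous_bisimilarityMetric_cp hP lam hlam,
    fun lam _ _ k => PGSOS.isLipschitz_upToMetric_cp hP lam k,
    fun hs _ hpos hlam ⟨K, hK⟩ =>
      PGSOS.not_isLipschitz_bisimilarityMetric_cp hP hs hpos hlam K hK⟩
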